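/- Let $(V',\omega'=d\alpha')$ be a finite-dimensional exact symplectic manifold (smooth, Hausdorff, without boundary) and let $W'$ be a non-empty compact smooth manifold without boundary. Let $F':W'\times[0,1]\to V'$ be a smooth map such that every $F'_t=F'(\cdot,t)$ is a Lagrangian embedding, $F_0'^*\alpha'$ is exact (so $W'$ is an exact Lagrangian submanifold of $V'$ via $F'_0$), and the isotopy is exact, i.e. the class of $F_t'^*\alpha'$, taken relative to $F_0'^*\alpha'$, is constant: $F_t'^*\alpha'-F_0'^*\alpha'$ is exact for all $t\in[0,1]$. Assume moreover that $F'_0(W')\cap F'_1(W')=\emptyset$. Parametrize $S^1$ by $\Theta\in[-1,1]$ with $-1$ and $1$ identified, let $0<\delta<\tfrac12$, and let $I_0$, $I_1$ be the $\delta$-neighbourhoods of $0$ and of $\pm1$ in $S^1$. Then: (a) There are smooth maps $\rho:S^1\to[0,1]$ with $\rho=0$ on $I_0$ and $\rho=1$ on $I_1$. (b) There are smooth functions $\psi:W'\times[0,1]\to\mathbb R$ with $F'^*\omega'=d(-\psi\,dt)=-d\psi\wedge dt$ on $W'\times[0,1]$. (c) For every such $\rho$ and $\psi$, put $\Phi(w',\Theta)=\psi(w',\rho(\Theta))\,\rho'(\Theta)$.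 Then $\Phi$ has a minimum $\Phi_-$ and a maximum $\Phi_+$ on $W'\times S^1$, and there is a smooth map $\alpha:S^1\times\mathbb R\to\mathbb R^2$ such that (i) on $S^1\times[\Phi_-,\Phi_+]$ the pull-back of $dx\wedge dy$ under $\alpha$ is $d\Phi\wedge d\Theta$, where $\Phi$ here denotes the coordinate on the second factor; (ii) $\alpha$ is injective on $I\times[\Phi_-,\Phi_+]$ for some closed $I\subset S^1$ with $I\cup I_0\cup I_1=S^1$; moreover $\alpha(0,0)=\alpha(\pm1,0)=0$, and this is the only double point of $\alpha$ on $S^1\times\{0\}$; (iii) $\int_{\alpha(S^1\times 0)}x\,dy=0$; and such that $$F:W'\times S^1\to V'\times\mathbb R^2,\qquad F(w',\Theta)=\bigl(F'(w',\rho(\Theta)),\ \alpha(\Theta,\Phi(w',\Theta))\bigr)$$ is an exact Lagrangian embedding into $(V'\times\mathbb R^2,\ \omega'\oplus dx\wedge dy)$, i.e. $F$ is a smooth embedding, $\dim(V'\times\mathbb R^2)=2\dim(W'\times S^1)$, $F^*(\omega'\oplus dx\wedge dy)=0$ and $F^*(\alpha'\oplus x\,dy)$ is exact. -/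

import Mathlib

open scoped Manifold ContDiff Topology

noncomputable section

namespace FigureEight

section Forms

variable {E H M E' H' N : Type*}
  [NormedAddCommGroup E] [NormedSpace ℝ E] [TopologicalSpace H]
  [TopologicalSpace M] [ChartedSpace H M]
  [NormedAddCommGroup E'] [NormedSpace ℝ E'] [TopologicalSpace H']
  [TopologicalSpace N] [ChartedSpace H' N]

/-- (Not necessarily smooth) differential 1-forms on a manifold. -/
abbrev OneForm (I : ModelWithCorners ℝ E H) (M : Type*) [TopologicalSpace M]
    [ChartedSpace H M] : Type _ :=
  ∀ x : M, TangentSpace I x →L[ℝ] ℝ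

/-- 2-forms, recorded through their values `σ x u v` on pairs of tangent vectors. All the 2-forms
used below (`OneForm.extDeriv`, `area`, `sumTwo`) are bilinear and alternating by construction. -/
abbrev TwoForm (I : ModelWithCorners ℝ E H) (M : Type*) [TopologicalSpace M]
    [ChartedSpace H M] : Type _ :=
  ∀ x : M, TangentSpace I x → TangentSpace I x → ℝ

/-- The pull-back `f^* θ`. -/
def OneForm.pullback (J : ModelWithCorners ℝ E' H') {I : ModelWithCorners ℝ E H}
    (θ : OneForm I M) (f : N → M) : OneForm J N :=
  fun x => (θ (f x)).comp (mfderiv J I f x)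

/-- A 1-form is exact if it is the differential of a smooth function. -/
def OneForm.IsExact {I : ModelWithCorners ℝ E H} (θ : OneForm I M) : Prop :=
  ∃ g : M → ℝ, ContMDiff I 𝓘(ℝ, ℝ) ∞ g ∧
    ∀ (x : M) (u : TangentSpace I x), θ x u = (mfderiv I 𝓘(ℝ, ℝ) g x u : ℝ)

/-- `f : N → M` is a Lagrangian embedding for the 2-form `σ` on `M`: a smooth map of finite
dimensional manifolds which is an immersion and a homeomorphism onto its image, such that
`f^* σ = 0` and `dim M = 2 dim N`. -/
structure IsLagrangianEmbedding (J : ModelWithCorners ℝ E' H') (I : ModelWithCorners ℝ E H)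
    (σ : TwoForm I M) (f : N → M) : Prop where
  contMDiff : ContMDiff J I ∞ f
  immersion : ∀ x, Function.Injective (mfderiv J I f x)
  isEmbedding : Topology.IsEmbedding f
  isotropic : ∀ (x : N) (u v : TangentSpace J x),
    σ (f x) (mfderiv J I f x u) (mfderiv J I f x v) = 0
  dim : Module.finrank ℝ E = 2 * Module.finrank ℝ E'

/-- An exact Lagrangian embedding into `(M, σ)`, where `σ = dθ`: the form `f^* θ` is exact. -/
structure IsExactLagrangianEmbedding (J : ModelWithCorners ℝ E' H') (I : ModelWithCorners ℝ E H)
    (θ : OneForm I M) (σ : TwoForm I M) (f : N → M) : Prop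
    extends IsLagrangianEmbedding J I σ f where
  exact : (θ.pullback J f).IsExact

end Forms

section ExactSymplectic

variable {E V : Type*} [NormedAddCommGroup E] [NormedSpace ℝ E]
  [TopologicalSpace V] [ChartedSpace E V]

/-- Smooth 1-forms: smooth sections of the cotangent bundle. -/
def OneForm.IsSmooth [IsManifold 𝓘(ℝ, E) ∞ V] (θ : OneForm 𝓘(ℝ, E) V) : Prop :=
  ContMDiff 𝓘(ℝ, E) (𝓘(ℝ, E).prod 𝓘(ℝ, E →L[ℝ] ℝ)) ∞
    (fun x => Bundle.TotalSpace.mk' (E →L[ℝ] ℝ)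
      (E := fun x : V => TangentSpace 𝓘(ℝ, E) x →L[ℝ] Bundle.Trivial V ℝ x) x (θ x))

/-- The expression of a 1-form in the preferred chart at `x`: the pull-back of `θ` under the
inverse of the chart. -/
def OneForm.inChart (θ : OneForm 𝓘(ℝ, E) V) (x : V) (y : E) : E →L[ℝ] ℝ :=
  (θ ((extChartAt 𝓘(ℝ, E) x).symm y)).comp
    (mfderiv 𝓘(ℝ, E) 𝓘(ℝ, E) (extChartAt 𝓘(ℝ, E) x).symm y)

/-- The exterior derivative `dθ`, computed at `x` in the chart at `x` by
`dβ(u, v) = (Dβ u) v - (Dβ v) u`. -/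
def OneForm.extDeriv (θ : OneForm 𝓘(ℝ, E) V) : TwoForm 𝓘(ℝ, E) V := fun x u v =>
  let φ := extChartAt 𝓘(ℝ, E) x
  let u' : E := mfderiv 𝓘(ℝ, E) 𝓘(ℝ, E) φ x u
  let v' : E := mfderiv 𝓘(ℝ, E) 𝓘(ℝ, E) φ x v
  fderiv ℝ (θ.inChart x) (φ x) u' v' - fderiv ℝ (θ.inChart x) (φ x) v' u'

/-- `(V, dθ)` is an exact symplectic manifold with the smooth primitive `θ`. -/
structure IsExactSymplectic [IsManifold 𝓘(ℝ, E) ∞ V] (θ : OneForm 𝓘(ℝ, E) V) : Prop where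
  smooth : θ.IsSmooth
  nondegenerate : ∀ (x : V) (u : TangentSpace 𝓘(ℝ, E) x),
    (∀ v : TangentSpace 𝓘(ℝ, E) x, θ.extDeriv x u v = 0) → u = 0

/-- The 1-form `x dy` on `ℝ²`. -/
def xdy : OneForm 𝓘(ℝ, ℝ × ℝ) (ℝ × ℝ) :=
  fun p => p.1 • (ContinuousLinearMap.snd ℝ ℝ ℝ : ℝ × ℝ →L[ℝ] ℝ)

/-- The value of `dx ∧ dy` on two vectors of `ℝ²`. -/
def det2 (u v : ℝ × ℝ) : ℝ := u.1 * v.2 - u.2 * v.1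

/-- The area form `dx ∧ dy` on `ℝ²`. -/
def area : TwoForm 𝓘(ℝ, ℝ × ℝ) (ℝ × ℝ) := fun _ u v => det2 u v

/-- The 1-form `θ ⊕ x dy` on `V × ℝ²`. -/
def sumOne (θ : OneForm 𝓘(ℝ, E) V) : OneForm (𝓘(ℝ, E).prod 𝓘(ℝ, ℝ × ℝ)) (V × (ℝ × ℝ)) :=
  θ.pullback (𝓘(ℝ, E).prod 𝓘(ℝ, ℝ × ℝ)) Prod.fst +
    xdy.pullback (𝓘(ℝ, E).prod 𝓘(ℝ, ℝ × ℝ)) Prod.snd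

/-- The 2-form `σ ⊕ dx ∧ dy` on `V × ℝ²`. -/
def sumTwo (σ : TwoForm 𝓘(ℝ, E) V) : TwoForm (𝓘(ℝ, E).prod 𝓘(ℝ, ℝ × ℝ)) (V × (ℝ × ℝ)) :=
  fun p u v =>
    σ p.1 (mfderiv (𝓘(ℝ, E).prod 𝓘(ℝ, ℝ × ℝ)) 𝓘(ℝ, E) Prod.fst p u)
        (mfderiv (𝓘(ℝ, E).prod 𝓘(ℝ, ℝ × ℝ)) 𝓘(ℝ, E) Prod.fst p v) +
      area p.2 (mfderiv (𝓘(ℝ, E).prod 𝓘(ℝ, ℝ × ℝ)) 𝓘(ℝ, ℝ × ℝ) Prod.snd p u)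
        (mfderiv (𝓘(ℝ, E).prod 𝓘(ℝ, ℝ × ℝ)) 𝓘(ℝ, ℝ × ℝ) Prod.snd p v)

end ExactSymplectic

section Isotopy

variable {E V E' W : Type*} [NormedAddCommGroup E] [NormedSpace ℝ E]
  [TopologicalSpace V] [ChartedSpace E V]
  [NormedAddCommGroup E'] [NormedSpace ℝ E']
  [TopologicalSpace W] [ChartedSpace E' W]

/-- The subset `W × [0,1]` of `W × ℝ`. -/
def cylinder (W : Type*) : Set (W × ℝ) := Set.univ ×ˢ Set.Icc (0 : ℝ) 1

/-- An exact Lagrangian isotopy of `W` in `(V, dθ)`, parametrized by `[0,1]` (the values of `F`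
outside `W × [0,1]` are irrelevant). Here `F^* θ` is a primitive of `F^* (dθ)`, and the class of its
restriction to `W × {t}` in `H¹(W; ℝ)` is required not to depend on `t`. -/
structure IsExactLagrangianIsotopy (θ : OneForm 𝓘(ℝ, E) V) (F : W × ℝ → V) : Prop where
  smooth : ContMDiffOn (𝓘(ℝ, E').prod 𝓘(ℝ, ℝ)) 𝓘(ℝ, E) ∞ F (cylinder W)
  lagrangian : ∀ t ∈ Set.Icc (0 : ℝ) 1,
    IsLagrangianEmbedding 𝓘(ℝ, E') 𝓘(ℝ, E) θ.extDeriv (fun w => F (w, t))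
  exact : ∀ t ∈ Set.Icc (0 : ℝ) 1, OneForm.IsExact
    (θ.pullback 𝓘(ℝ, E') (fun w => F (w, t)) - θ.pullback 𝓘(ℝ, E') (fun w => F (w, 0)))

/-- `ψ` is a smooth function on `W × [0,1]` such that `-ψ dt` is a primitive of the pull-back
of `σ` under `F : W × [0,1] → V`, i.e. `F^* σ = d(-ψ dt) = -dψ ∧ dt` on `W × [0,1]`. -/
structure IsPotential (σ : TwoForm 𝓘(ℝ, E) V) (F : W × ℝ → V) (ψ : W × ℝ → ℝ) : Prop where
  smooth : ContMDiffOn (𝓘(ℝ, E').prod 𝓘(ℝ, ℝ)) 𝓘(ℝ, ℝ) ∞ ψ (cylinder W)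
  eq : ∀ p ∈ cylinder W, ∀ u v : TangentSpace (𝓘(ℝ, E').prod 𝓘(ℝ, ℝ)) p,
    let DF := mfderivWithin (𝓘(ℝ, E').prod 𝓘(ℝ, ℝ)) 𝓘(ℝ, E) F (cylinder W) p
    let dψ : TangentSpace (𝓘(ℝ, E').prod 𝓘(ℝ, ℝ)) p → ℝ := fun a =>
      mfderivWithin (𝓘(ℝ, E').prod 𝓘(ℝ, ℝ)) 𝓘(ℝ, ℝ) ψ (cylinder W) p a
    let dt : TangentSpace (𝓘(ℝ, E').prod 𝓘(ℝ, ℝ)) p → ℝ := fun a =>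
      mfderiv (𝓘(ℝ, E').prod 𝓘(ℝ, ℝ)) 𝓘(ℝ, ℝ) Prod.snd p a
    σ (F p) (DF u) (DF v) = -(dψ u * dt v - dψ v * dt u)

end Isotopy

section FigureEightMap

/-- The point of `S¹` with parameter `s`, where `S¹` is parametrized by `[-1,1]` with `-1` and `1`
identified. -/
def pt (s : ℝ) : Circle := Circle.exp (Real.pi * s)

/-- The derivative with respect to the parameter of `S¹`. -/
def dTheta {X : Type*} [NormedAddCommGroup X] [NormedSpace ℝ X] (g : Circle → X) (z : Circle) : X :=
  deriv (fun s : ℝ => g (z * pt s)) 0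

/-- The `δ`-neighbourhood in `S¹` of the point with parameter `c`. -/
def arc (c δ : ℝ) : Set Circle := pt '' {s | |s - c| < δ}

/-- Smooth maps `ρ : S¹ → [0,1]` which are `0` on the `δ`-neighbourhood of `0` and `1` on the
`δ`-neighbourhood of `±1`. -/
structure IsCutoff (δ : ℝ) (ρ : Circle → ℝ) : Prop where
  smooth : ContMDiff (𝓡 1) 𝓘(ℝ, ℝ) ∞ ρ
  mem_Icc : ∀ z, ρ z ∈ Set.Icc (0 : ℝ) 1
  eq_zero : ∀ z ∈ arc 0 δ, ρ z = 0
  eq_one : ∀ z ∈ arc 1 δ, ρ z = 1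

/-- The function `Φ(w, Θ) = ψ(w, ρ(Θ)) ρ'(Θ)` on `W × S¹`. -/
def Phi {W : Type*} (ψ : W × ℝ → ℝ) (ρ : Circle → ℝ) (q : W × Circle) : ℝ :=
  ψ (q.1, ρ q.2) * dTheta ρ q.2

/-- The requirements on the map `a` of the annulus `S¹ × [m, M]` into `ℝ²`. Smoothness on the
closed annulus is expressed by a smooth extension to `S¹ × ℝ`. -/
structure IsFigureEightMap (δ m M : ℝ) (a : Circle × ℝ → ℝ × ℝ) : Prop where
  smooth : ContMDiff ((𝓡 1).prod 𝓘(ℝ, ℝ)) 𝓘(ℝ, ℝ × ℝ) ∞ a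
  /-- The pull-back of `dx ∧ dy` is `dΦ ∧ dΘ`. -/
  area : ∀ z : Circle, ∀ s ∈ Set.Icc m M,
    det2 (deriv (fun r : ℝ => a (z, r)) s) (dTheta (fun z' => a (z', s)) z) = 1
  /-- Injectivity away from the double point of the figure eight. -/
  injOn : ∃ K : Set Circle, IsClosed K ∧ K ∪ arc 0 δ ∪ arc 1 δ = Set.univ ∧
    Set.InjOn a (K ×ˢ Set.Icc m M)
  zero : a (pt 0, 0) = 0
  one : a (pt 1, 0) = 0
  /-- The origin is the only double point of the restriction to `S¹ × {0}`. -/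
  double : ∀ z z' : Circle, z ≠ z' → a (z, 0) = a (z', 0) →
    (z = pt 0 ∧ z' = pt 1) ∨ (z = pt 1 ∧ z' = pt 0)
  /-- The curve `a(S¹ × {0})` bounds zero area: the integral of `x dy` over it vanishes. -/
  zeroArea : ∫ s in (-1 : ℝ)..1, (a (pt s, 0)).1 * deriv (fun r : ℝ => (a (pt r, 0)).2) s = 0

/-- The map `(w, Θ) ↦ (F(w, ρ(Θ)), a(Θ, Φ(w, Θ)))`. -/
def figureEight {W V : Type*} (F : W × ℝ → V) (ψ : W × ℝ → ℝ) (ρ : Circle → ℝ)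
    (a : Circle × ℝ → ℝ × ℝ) (q : W × Circle) : V × (ℝ × ℝ) :=
  (F (q.1, ρ q.2), a (q.2, Phi ψ ρ q))

end FigureEightMap

end FigureEight

end

open scoped Manifold ContDiff Topology

/-! Write `ζ` for the pull-back of `θ` to `W × [0,1]`. Exactness of the isotopy gives, for each `t`,
a primitive `g_t` of `ζ_t - ζ_0`. Normalized at a base point of every connected component, these
primitives depend smoothly on `t` (`exists_smooth_primitive_family`), and `ψ = ∂_t g - θ(∂_t F)` is
a potential (`exists_isPotential`): the part of `dζ` along `W` vanishes since each `F_t` is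
Lagrangian, and the mixed part is `-dψ ∧ dt`. Conversely, for any potential the form `ζ + ψ dt` is
closed and exact at `t = 0`, so it has a primitive `G` (`exists_primitive_cylinder`).

The map of the annulus is explicit. With `z = x + iy` on the circle, put `a = (l (y - r), 2 l x (y -
2 r))`, where `r` is the small root of `2 π l² (r - y r²) = s`. For `s = 0` this is the curve `l
(sin πΘ, sin 2πΘ)`, a figure eight with its double point at `Θ = 0, ±1`. The equation for `r` makes
the area condition an identity (`eightMap_area`) and gives `a^*(x dy) = db + s dΘ` with an explicit
`b`. Taking `l` large makes `r` small compared with `|y|` away from the two arcs, and there an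
elementary comparison yields injectivity (`root_injective`).

In `W × S¹`, `ρ' = 0` over the arcs, so `Φ = 0` there and `a` is evaluated only on the curve;
coincidences of the plane component with different `Θ` occur only between `Θ = 0` and `Θ = ±1`,
where the `V` components lie in the disjoint sets `F_0(W)` and `F_1(W)`. At a fixed `Θ` injectivity
is that of `F_ρ(Θ)`. The forms cancel: the `V` part contributes `-ρ' dψ ∧ dΘ`, while the plane part
contributes `dΦ ∧ dΘ = ρ' dψ ∧ dΘ`. The pull-back of `θ ⊕ x dy` is `(dG - ψ ρ' dΘ) + (db + Φ dΘ) =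
d(G + b)`. -/

namespace FigureEight

/-! ### Pull-backs of 1-forms to subsets of a normed space, and their exterior derivative -/

section PullbackCalculus

variable {E V P : Type*} [NormedAddCommGroup E] [NormedSpace ℝ E]
  [TopologicalSpace V] [ChartedSpace E V] [IsManifold 𝓘(ℝ, E) ∞ V]
  [NormedAddCommGroup P] [NormedSpace ℝ P]

/-- The local expression of a smooth 1-form is smooth at the centre of the chart. -/
lemma OneForm.IsSmooth.contDiffAt_inChart {θ : OneForm 𝓘(ℝ, E) V} (hθ : θ.IsSmooth) (x : V) :
    ContDiffAt ℝ ∞ (θ.inChart x) (extChartAt 𝓘(ℝ, E) x x) := by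
  have : IsManifold 𝓘(ℝ, E) 1 V := IsManifold.of_le (n := ∞) (by simp)
  have h1 := ((contMDiffAt_hom_bundle _).1 (hθ x)).2
  have hsymm : ContMDiffAt 𝓘(ℝ, E) 𝓘(ℝ, E) ∞ (extChartAt 𝓘(ℝ, E) x).symm
      (extChartAt 𝓘(ℝ, E) x x) :=
    (contMDiffOn_extChartAt_symm x).contMDiffAt (extChartAt_target_mem_nhds x)
  have h2 := ContMDiffAt.comp_of_eq (x := extChartAt 𝓘(ℝ, E) x x) h1 hsymm
    (extChartAt_to_inv x)
  rw [← contMDiffAt_iff_contDiffAt]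
  -- Near the centre, the coordinate expression of the cotangent section, composed with the inverse
  -- chart, is `θ.inChart x`.
  refine h2.congr_of_eventuallyEq ?_
  filter_upwards [extChartAt_target_mem_nhds (I := 𝓘(ℝ, E)) x] with y hy
  have hs : (extChartAt 𝓘(ℝ, E) x).symm y ∈ (chartAt E x).source := by
    simpa using (extChartAt 𝓘(ℝ, E) x).map_target hy
  ext u
  simp only [OneForm.inChart, Function.comp, ContinuousLinearMap.inCoordinates,
    ContinuousLinearMap.comp_apply]
  rw [TangentBundle.symmL_trivializationAt hs]
  have hr : Set.range 𝓘(ℝ, E) = Set.univ := by simp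
  rw [hr, mfderivWithin_univ, (extChartAt 𝓘(ℝ, E) x).right_inv hy]
  simp [Bundle.Trivial.continuousLinearMapAt_trivialization]
  rfl

/-- The pull-back of a 1-form by a map defined on a subset `S` of a normed space. -/
noncomputable def pullOn (θ : OneForm 𝓘(ℝ, E) V) (f : P → V) (S : Set P) (p : P) : P →L[ℝ] ℝ :=
  (θ (f p)).comp (mfderivWithin 𝓘(ℝ, P) 𝓘(ℝ, E) f S p)

/-- Inserting the chart and its inverse between `f` and `θ` changes nothing, by the chain rule. This
reduces smoothness and exterior derivatives of pull-backs to calculus in normed spaces. -/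
lemma pullOn_eventuallyEq (θ : OneForm 𝓘(ℝ, E) V) {f : P → V} {S : Set P}
    (hS : UniqueDiffOn ℝ S) (hf : ContMDiffOn 𝓘(ℝ, P) 𝓘(ℝ, E) ∞ f S) {p : P} (hp : p ∈ S) :
    ∀ᶠ q in 𝓝[S] p, pullOn θ f S q =
      (θ.inChart (f p) (extChartAt 𝓘(ℝ, E) (f p) (f q))).comp
        (fderivWithin ℝ (fun q => extChartAt 𝓘(ℝ, E) (f p) (f q)) S q) := by
  have : IsManifold 𝓘(ℝ, E) 1 V := IsManifold.of_le (n := ∞) (by simp)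
  have hc : ∀ᶠ q in 𝓝[S] p, f q ∈ (extChartAt 𝓘(ℝ, E) (f p)).source :=
    (hf.continuousOn p hp).eventually (extChartAt_source_mem_nhds (f p))
  filter_upwards [hc, self_mem_nhdsWithin] with q hq hqS
  have hfq : MDifferentiableWithinAt 𝓘(ℝ, P) 𝓘(ℝ, E) f S q :=
    (hf q hqS).mdifferentiableWithinAt (by simp)
  have hch : MDifferentiableAt 𝓘(ℝ, E) 𝓘(ℝ, E) (extChartAt 𝓘(ℝ, E) (f p)) (f q) :=
    mdifferentiableAt_extChartAt (by simpa using hq)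
  have h1 : mfderivWithin 𝓘(ℝ, P) 𝓘(ℝ, E) (fun q => extChartAt 𝓘(ℝ, E) (f p) (f q)) S q =
      (mfderiv 𝓘(ℝ, E) 𝓘(ℝ, E) (extChartAt 𝓘(ℝ, E) (f p)) (f q)).comp
        (mfderivWithin 𝓘(ℝ, P) 𝓘(ℝ, E) f S q) :=
    mfderiv_comp_mfderivWithin q hch hfq (hS q hqS).uniqueMDiffWithinAt
  have h2 := mfderivWithin_extChartAt_symm_comp_mfderiv_extChartAt' (I := 𝓘(ℝ, E)) hq
  rw [← mfderivWithin_eq_fderivWithin, h1]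
  have hr : Set.range 𝓘(ℝ, E) = Set.univ := by simp
  rw [hr, mfderivWithin_univ] at h2
  ext u
  have h3 := DFunLike.congr_fun h2 (mfderivWithin 𝓘(ℝ, P) 𝓘(ℝ, E) f S q u)
  -- The two base points are equal only propositionally; viewing every tangent space as the model
  -- space `E` allows the transport.
  have h4 : ∀ (x y : V) (v w : E), x = y → v = w → (show E →L[ℝ] ℝ from θ x) v =
      (show E →L[ℝ] ℝ from θ y) w := by rintro x _ v _ rfl rfl; rfl
  exact h4 _ _ _ _ ((extChartAt 𝓘(ℝ, E) (f p)).left_inv hq).symm h3.symm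

omit [IsManifold 𝓘(ℝ, E) ∞ V] in
lemma contDiffWithinAt_chart_comp {f : P → V} {S : Set P}
    (hf : ContMDiffOn 𝓘(ℝ, P) 𝓘(ℝ, E) ∞ f S) {p : P} (hp : p ∈ S) :
    ContDiffWithinAt ℝ ∞ (fun q => extChartAt 𝓘(ℝ, E) (f p) (f q)) S p := by
  have : ContMDiffAt 𝓘(ℝ, E) 𝓘(ℝ, E) ∞ (extChartAt 𝓘(ℝ, E) (f p)) (f p) :=
    contMDiffAt_extChartAt
  exact (this.comp_contMDiffWithinAt p (hf p hp)).contDiffWithinAt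

lemma contDiffOn_pullOn {θ : OneForm 𝓘(ℝ, E) V} (hθ : θ.IsSmooth) {f : P → V} {S : Set P}
    (hS : UniqueDiffOn ℝ S) (hf : ContMDiffOn 𝓘(ℝ, P) 𝓘(ℝ, E) ∞ f S) :
    ContDiffOn ℝ ∞ (pullOn θ f S) S := by
  intro p hp
  have h1 := contDiffWithinAt_chart_comp hf hp
  have h2 : ContDiffWithinAt ℝ ∞
      (fun q => θ.inChart (f p) (extChartAt 𝓘(ℝ, E) (f p) (f q))) S p :=
    ContDiffAt.comp_contDiffWithinAt (g := θ.inChart (f p)) p (hθ.contDiffAt_inChart (f p)) h1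
  have h3 := h1.fderivWithin_right (m := ∞) hS (by simp) hp
  refine (h2.clm_comp h3).congr_of_eventuallyEq (pullOn_eventuallyEq θ hS hf hp)
    ((pullOn_eventuallyEq θ hS hf hp).self_of_nhdsWithin hp)

/-- The exterior derivative commutes with pull-backs. -/
lemma fderivWithin_pullOn_sub {θ : OneForm 𝓘(ℝ, E) V} (hθ : θ.IsSmooth) {f : P → V} {S : Set P}
    (hS : UniqueDiffOn ℝ S) (hSi : S ⊆ closure (interior S))
    (hf : ContMDiffOn 𝓘(ℝ, P) 𝓘(ℝ, E) ∞ f S) {p : P} (hp : p ∈ S) (u v : P) :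
    fderivWithin ℝ (pullOn θ f S) S p u v - fderivWithin ℝ (pullOn θ f S) S p v u =
      θ.extDeriv (f p) (mfderivWithin 𝓘(ℝ, P) 𝓘(ℝ, E) f S p u)
        (mfderivWithin 𝓘(ℝ, P) 𝓘(ℝ, E) f S p v) := by
  have : IsManifold 𝓘(ℝ, E) 1 V := IsManifold.of_le (n := ∞) (by simp)
  set φ : P → E := fun q => extChartAt 𝓘(ℝ, E) (f p) (f q) with hφ
  have h1 : ContDiffWithinAt ℝ ∞ φ S p := contDiffWithinAt_chart_comp hf hp
  have hev := pullOn_eventuallyEq θ hS hf hp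
  have hd1 : HasFDerivWithinAt (fun q => θ.inChart (f p) (φ q))
      ((fderiv ℝ (θ.inChart (f p)) (φ p)).comp (fderivWithin ℝ φ S p)) S p :=
    HasFDerivAt.comp_hasFDerivWithinAt (g := θ.inChart (f p)) p
      ((hθ.contDiffAt_inChart (f p)).differentiableAt (by simp)).hasFDerivAt
      ((h1.differentiableWithinAt (by simp)).hasFDerivWithinAt)
  have hd2 : HasFDerivWithinAt (fderivWithin ℝ φ S)
      (fderivWithin ℝ (fderivWithin ℝ φ S) S p) S p :=
    ((h1.fderivWithin_right (m := ∞) hS (by simp) hp).differentiableWithinAt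
      (by simp)).hasFDerivWithinAt
  have hd := (hd1.clm_comp hd2).congr_of_eventuallyEq hev (hev.self_of_nhdsWithin hp)
  -- The product rule leaves a term with the second derivative of `φ`; its symmetry makes it cancel
  -- in the antisymmetrization.
  have hsymm : IsSymmSndFDerivWithinAt ℝ φ S p :=
    h1.isSymmSndFDerivWithinAt
    (by rw [minSmoothness_of_isRCLikeNormedField]; exact WithTop.coe_le_coe.2 le_top) hS (hSi hp) hp
  have hch : MDifferentiableAt 𝓘(ℝ, E) 𝓘(ℝ, E) (extChartAt 𝓘(ℝ, E) (f p)) (f p) :=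
    mdifferentiableAt_extChartAt (by simp)
  have hD : fderivWithin ℝ φ S p =
      (mfderiv 𝓘(ℝ, E) 𝓘(ℝ, E) (extChartAt 𝓘(ℝ, E) (f p)) (f p)).comp
        (mfderivWithin 𝓘(ℝ, P) 𝓘(ℝ, E) f S p) := by
    rw [← mfderivWithin_eq_fderivWithin]
    exact mfderiv_comp_mfderivWithin p hch ((hf p hp).mdifferentiableWithinAt (by simp))
      (hS p hp).uniqueMDiffWithinAt
  have hDa : ∀ w : P, fderivWithin ℝ φ S p w =
      mfderiv 𝓘(ℝ, E) 𝓘(ℝ, E) (extChartAt 𝓘(ℝ, E) (f p)) (f p)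
        (mfderivWithin 𝓘(ℝ, P) 𝓘(ℝ, E) f S p w) := fun w => DFunLike.congr_fun hD w
  rw [hd.fderivWithin (hS p hp)]
  simp only [OneForm.extDeriv]
  rw [← hDa, ← hDa]
  rw [show extChartAt 𝓘(ℝ, E) (f p) (f p) = φ p from rfl]
  simp [hsymm.eq u v]

end PullbackCalculus

end FigureEight

namespace FigureEight

/-! ### Smooth dependence of integrals on parameters in a convex set -/

section ParametricIntegral

variable {P : Type*} [NormedAddCommGroup P] [NormedSpace ℝ P]

/-- Compactness of `[0,1]` makes the partial derivative continuous in the parameter uniformly in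
`τ`; the mean value inequality on a ball intersected with `S` then bounds the remainder, and
integration preserves the bound. -/
lemma hasFDerivWithinAt_integral_param {S : Set P} (hc : Convex ℝ S) (hS : UniqueDiffOn ℝ S)
    {k : P × ℝ → ℝ} (hk : ContDiffOn ℝ 1 k (S ×ˢ Set.Icc (0 : ℝ) 1)) {p : P} (hp : p ∈ S) :
    HasFDerivWithinAt (fun q => ∫ τ in (0 : ℝ)..1, k (q, τ))
      (∫ τ in (0 : ℝ)..1, (fderivWithin ℝ k (S ×ˢ Set.Icc (0 : ℝ) 1) (p, τ)).comp
        (ContinuousLinearMap.inl ℝ P ℝ)) S p := by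
  set D := S ×ˢ Set.Icc (0 : ℝ) 1 with hD
  have hDu : UniqueDiffOn ℝ D := hS.prod (uniqueDiffOn_Icc one_pos)
  set k' : P → ℝ → P →L[ℝ] ℝ := fun p τ =>
    (fderivWithin ℝ k D (p, τ)).comp (ContinuousLinearMap.inl ℝ P ℝ) with hk'
  have hk'c : ContinuousOn (Function.uncurry k') D :=
    (hk.continuousOn_fderivWithin hDu le_rfl).clm_comp continuousOn_const
  have hder : ∀ q ∈ S, ∀ τ ∈ Set.Icc (0 : ℝ) 1,
      HasFDerivWithinAt (fun q => k (q, τ)) (k' q τ) S q := by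
    intro q hq τ hτ
    have h1 : HasFDerivWithinAt k (fderivWithin ℝ k D (q, τ)) D (q, τ) :=
      ((hk.differentiableOn one_ne_zero) (q, τ) ⟨hq, hτ⟩).hasFDerivWithinAt
    have h2 : HasFDerivWithinAt (fun q : P => (q, τ)) (ContinuousLinearMap.inl ℝ P ℝ) S q :=
      (hasFDerivAt_prodMk_left q τ).hasFDerivWithinAt
    exact HasFDerivWithinAt.comp (t := D) q h1 h2 fun x hx => ⟨hx, hτ⟩
  have hkc : ∀ q ∈ S, ContinuousOn (fun τ => k (q, τ)) (Set.Icc (0 : ℝ) 1) := fun q hq =>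
    hk.continuousOn.comp (by fun_prop) fun τ hτ => ⟨hq, hτ⟩
  have hk'p : ContinuousOn (fun τ => k' p τ) (Set.Icc (0 : ℝ) 1) :=
    hk'c.comp (by fun_prop) fun τ hτ => (⟨hp, hτ⟩ : (p, τ) ∈ D)
  have hint : ∀ q ∈ S, IntervalIntegrable (fun τ => k (q, τ)) MeasureTheory.volume 0 1 :=
    fun q hq => (hkc q hq).intervalIntegrable_of_Icc zero_le_one
  have hint' : IntervalIntegrable (fun τ => k' p τ) MeasureTheory.volume 0 1 :=
    hk'p.intervalIntegrable_of_Icc zero_le_one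
  refine hasFDerivWithinAt_iff_isLittleO.2 (Asymptotics.isLittleO_iff.2 fun c hc0 => ?_)
  obtain ⟨v, hv, hvc⟩ := (isCompact_Icc (a := (0 : ℝ)) (b := 1)).mem_uniformity_of_prod
    (f := k') hk'c hp (Metric.dist_mem_uniformity hc0)
  obtain ⟨r, hr, hrv⟩ := Metric.mem_nhdsWithin_iff.1 hv
  have hb : ∀ᶠ q in 𝓝[S] p, q ∈ Metric.ball p r ∩ S :=
    Filter.inter_mem (mem_nhdsWithin_of_mem_nhds (Metric.ball_mem_nhds p hr)) self_mem_nhdsWithin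
  have key : ∀ q ∈ Metric.ball p r ∩ S,
      ‖(∫ τ in (0 : ℝ)..1, k (q, τ)) - (∫ τ in (0 : ℝ)..1, k (p, τ)) -
        (∫ τ in (0 : ℝ)..1, k' p τ) (q - p)‖ ≤ c * ‖q - p‖ := by
    intro q hq
    have h1 : ∀ τ ∈ Set.Icc (0 : ℝ) 1, ‖k (q, τ) - k (p, τ) - k' p τ (q - p)‖ ≤ c * ‖q - p‖ := by
      intro τ hτ
      refine Convex.norm_image_sub_le_of_norm_hasFDerivWithin_le' (f := fun q => k (q, τ))
        (f' := fun q => k' q τ) (s := Metric.ball p r ∩ S)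
        (fun x hx => (hder x hx.2 τ hτ).mono Set.inter_subset_right) (fun x hx => ?_)
        ((convex_ball p r).inter hc) ⟨Metric.mem_ball_self hr, hp⟩ hq
      rw [← dist_eq_norm]
      exact (hvc x (hrv hx) τ hτ).le
    have h2 : IntervalIntegrable (fun τ => k' p τ (q - p)) MeasureTheory.volume 0 1 :=
      (hk'p.clm_apply continuousOn_const).intervalIntegrable_of_Icc zero_le_one
    rw [ContinuousLinearMap.intervalIntegral_apply hint',
      ← intervalIntegral.integral_sub (hint q hq.2) (hint p hp),
      ← intervalIntegral.integral_sub ((hint q hq.2).sub (hint p hp)) h2]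
    have h3 := intervalIntegral.norm_integral_le_of_norm_le_const (a := (0 : ℝ)) (b := 1)
      (C := c * ‖q - p‖) (f := fun τ => k (q, τ) - k (p, τ) - k' p τ (q - p))
      (fun τ hτ => h1 τ (by rw [Set.uIoc_of_le zero_le_one] at hτ; exact ⟨hτ.1.le, hτ.2⟩))
    simpa using h3
  exact hb.mono key

lemma contDiffOn_integral_param [FiniteDimensional ℝ P] {S : Set P} (hc : Convex ℝ S)
    (hS : UniqueDiffOn ℝ S) {k : P × ℝ → ℝ} (hk : ContDiffOn ℝ ∞ k (S ×ˢ Set.Icc (0 : ℝ) 1)) :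
    ContDiffOn ℝ ∞ (fun q => ∫ τ in (0 : ℝ)..1, k (q, τ)) S := by
  have hDu : UniqueDiffOn ℝ (S ×ˢ Set.Icc (0 : ℝ) 1) := hS.prod (uniqueDiffOn_Icc one_pos)
  -- The induction quantifies over all integrands, since the directional derivatives of the integral
  -- are integrals of the same kind with a new integrand.
  suffices H : ∀ (n : ℕ) (k : P × ℝ → ℝ), ContDiffOn ℝ ∞ k (S ×ˢ Set.Icc (0 : ℝ) 1) →
      ContDiffOn ℝ n (fun q => ∫ τ in (0 : ℝ)..1, k (q, τ)) S from
    contDiffOn_infty.2 fun n => H n k hk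
  intro n
  induction n with
  | zero =>
    intro k hk
    refine contDiffOn_zero.2 fun p hp => ?_
    exact (hasFDerivWithinAt_integral_param hc hS (hk.of_le (by simp)) hp).continuousWithinAt
  | succ n ih =>
    intro k hk
    have hd := fun p (hp : p ∈ S) =>
      hasFDerivWithinAt_integral_param hc hS (hk.of_le (by simp)) hp
    rw [Nat.cast_succ, contDiffOn_succ_iff_fderivWithin hS]
    refine ⟨fun p hp => (hd p hp).differentiableWithinAt, by simp, ?_⟩
    have hk1 : ContDiffOn ℝ ∞ (fderivWithin ℝ k (S ×ˢ Set.Icc (0 : ℝ) 1))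
        (S ×ˢ Set.Icc (0 : ℝ) 1) := hk.fderivWithin hDu (by simp)
    rw [contDiffOn_clm_apply]
    intro v
    refine (ih (fun q => fderivWithin ℝ k (S ×ˢ Set.Icc (0 : ℝ) 1) q (v, 0))
      (hk1.clm_apply contDiffOn_const)).congr fun p hp => ?_
    rw [(hd p hp).fderivWithin (hS p hp), ContinuousLinearMap.intervalIntegral_apply]
    · simp
    · refine ContinuousOn.intervalIntegrable_of_Icc zero_le_one ?_
      exact ContinuousOn.clm_comp (hk1.continuousOn.comp (by fun_prop)
        fun τ hτ => (⟨hp, hτ⟩ : (p, τ) ∈ S ×ˢ Set.Icc (0 : ℝ) 1)) continuousOn_const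

end ParametricIntegral

end FigureEight

namespace FigureEight

/-! ### Charts of the cylinder `W × [0,1]` -/

section CylinderCharts

variable {E' W : Type*} [NormedAddCommGroup E'] [NormedSpace ℝ E']
  [TopologicalSpace W] [ChartedSpace E' W]

/-- The product of the inverse of the chart of `W` at `w` with the identity of `ℝ`. -/
noncomputable def cylChart (w : W) (p : E' × ℝ) : W × ℝ := ((extChartAt 𝓘(ℝ, E') w).symm p.1, p.2)

/-- The set `B × [0,1]`. -/
def box (B : Set E') : Set (E' × ℝ) := B ×ˢ Set.Icc (0 : ℝ) 1

lemma mapsTo_cylChart (w : W) (B : Set E') : Set.MapsTo (cylChart w) (box B) (cylinder W) :=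
  fun _ hp => ⟨Set.mem_univ _, hp.2⟩

lemma uniqueDiffOn_box {B : Set E'} (hB : IsOpen B) : UniqueDiffOn ℝ (box B) :=
  hB.uniqueDiffOn.prod (uniqueDiffOn_Icc one_pos)

omit [NormedSpace ℝ E'] in
lemma box_subset_closure_interior {B : Set E'} (hB : IsOpen B) :
    box B ⊆ closure (interior (box B)) := by
  rw [box, interior_prod_eq, closure_prod_eq, hB.interior_eq, interior_Icc,
    closure_Ioo zero_ne_one]
  exact Set.prod_mono subset_closure le_rfl

lemma convex_box {B : Set E'} (hB : Convex ℝ B) : Convex ℝ (box B) := hB.prod (convex_Icc 0 1)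

lemma cylChart_extChartAt (w : W) (t : ℝ) :
    cylChart w (extChartAt 𝓘(ℝ, E') w w, t) = (w, t) := by simp [cylChart]

/-- Every point of a manifold is the centre of a chart ball contained in its component. -/
lemma exists_chart_ball (w : W) : ∃ r > 0,
    Metric.ball (extChartAt 𝓘(ℝ, E') w w) r ⊆ (extChartAt 𝓘(ℝ, E') w).target :=
  Metric.isOpen_iff.1 (isOpen_extChartAt_target w) _ (mem_extChartAt_target w)

variable [IsManifold 𝓘(ℝ, E') ∞ W]

lemma contMDiffOn_cylChart (w : W) :
    ContMDiffOn 𝓘(ℝ, E' × ℝ) (𝓘(ℝ, E').prod 𝓘(ℝ, ℝ)) ∞ (cylChart w)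
      ((extChartAt 𝓘(ℝ, E') w).target ×ˢ Set.univ) := by
  refine ContMDiffOn.prodMk ?_ contDiff_snd.contMDiff.contMDiffOn
  exact (contMDiffOn_extChartAt_symm w).comp contDiff_fst.contMDiff.contMDiffOn fun p hp => hp.1

lemma mdifferentiableAt_cylChart (w : W) {p : E' × ℝ}
    (hp : p.1 ∈ (extChartAt 𝓘(ℝ, E') w).target) :
    MDifferentiableAt 𝓘(ℝ, E' × ℝ) (𝓘(ℝ, E').prod 𝓘(ℝ, ℝ)) (cylChart w) p :=
  ((contMDiffOn_cylChart w).contMDiffAt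
    (((isOpen_extChartAt_target w).prod isOpen_univ).mem_nhds ⟨hp, Set.mem_univ _⟩)).mdifferentiableAt
      (by simp)

lemma mfderiv_cylChart (w : W) {p : E' × ℝ} (hp : p.1 ∈ (extChartAt 𝓘(ℝ, E') w).target)
    (u : E' × ℝ) :
    mfderiv 𝓘(ℝ, E' × ℝ) (𝓘(ℝ, E').prod 𝓘(ℝ, ℝ)) (cylChart w) p u =
      (mfderiv 𝓘(ℝ, E') 𝓘(ℝ, E') (extChartAt 𝓘(ℝ, E') w).symm p.1 u.1, u.2) := by
  have h1 : MDifferentiableAt 𝓘(ℝ, E') 𝓘(ℝ, E') (extChartAt 𝓘(ℝ, E') w).symm p.1 :=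
    ((contMDiffOn_extChartAt_symm (n := ∞) w).contMDiffAt
      ((isOpen_extChartAt_target w).mem_nhds hp)).mdifferentiableAt (by simp)
  have h2 : MDifferentiableAt 𝓘(ℝ, E' × ℝ) 𝓘(ℝ, E') (Prod.fst : E' × ℝ → E') p :=
    contDiff_fst.contMDiff.mdifferentiableAt (n := 1) one_ne_zero
  have h3 : MDifferentiableAt 𝓘(ℝ, E' × ℝ) 𝓘(ℝ, ℝ) (Prod.snd : E' × ℝ → ℝ) p :=
    contDiff_snd.contMDiff.mdifferentiableAt (n := 1) one_ne_zero
  have h4 := mfderiv_prodMk (h1.comp p h2) h3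
  have h5 := mfderiv_comp p h1 h2
  change mfderiv 𝓘(ℝ, E' × ℝ) (𝓘(ℝ, E').prod 𝓘(ℝ, ℝ))
    (fun p : E' × ℝ => (((extChartAt 𝓘(ℝ, E') w).symm ∘ Prod.fst) p, p.2)) p u = _
  rw [h4, h5, mfderiv_eq_fderiv, mfderiv_eq_fderiv, fderiv_snd, fderiv_fst]
  rfl

/-- The derivative of an inverse chart is invertible; hence identities between forms on the cylinder
may be checked in the model space. -/
lemma mfderiv_cylChart_surjective (w : W) {p : E' × ℝ}
    (hp : p.1 ∈ (extChartAt 𝓘(ℝ, E') w).target)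
    (a : TangentSpace (𝓘(ℝ, E').prod 𝓘(ℝ, ℝ)) (cylChart w p)) :
    ∃ u : E' × ℝ, mfderiv 𝓘(ℝ, E' × ℝ) (𝓘(ℝ, E').prod 𝓘(ℝ, ℝ)) (cylChart w) p u = a := by
  have : IsManifold 𝓘(ℝ, E') 1 W := IsManifold.of_le (n := ∞) (by simp)
  obtain ⟨u, b⟩ := a
  have h := (isInvertible_mfderivWithin_extChartAt_symm (I := 𝓘(ℝ, E')) hp).bijective.surjective
  have hr : Set.range 𝓘(ℝ, E') = Set.univ := by simp
  rw [hr, mfderivWithin_univ] at h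
  obtain ⟨v, hv⟩ := h u
  refine ⟨(v, b), ?_⟩
  rw [mfderiv_cylChart w hp]
  exact Prod.ext hv rfl

variable {E'' H'' N : Type*} [NormedAddCommGroup E''] [NormedSpace ℝ E''] [TopologicalSpace H'']
  [TopologicalSpace N] [ChartedSpace H'' N] {J : ModelWithCorners ℝ E'' H''}

lemma mfderivWithin_comp_cylChart (w : W) {B : Set E'} (hB : IsOpen B)
    (hBt : B ⊆ (extChartAt 𝓘(ℝ, E') w).target) {f : W × ℝ → N} {p : E' × ℝ} (hp : p ∈ box B)
    (hf : MDifferentiableWithinAt (𝓘(ℝ, E').prod 𝓘(ℝ, ℝ)) J f (cylinder W) (cylChart w p))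
    (u : E' × ℝ) :
    mfderivWithin 𝓘(ℝ, E' × ℝ) J (f ∘ cylChart w) (box B) p u =
      mfderivWithin (𝓘(ℝ, E').prod 𝓘(ℝ, ℝ)) J f (cylinder W) (cylChart w p)
        (mfderiv 𝓘(ℝ, E' × ℝ) (𝓘(ℝ, E').prod 𝓘(ℝ, ℝ)) (cylChart w) p u) := by
  have hc := mdifferentiableAt_cylChart w (hBt hp.1)
  have hu : UniqueMDiffWithinAt 𝓘(ℝ, E' × ℝ) (box B) p :=
    (uniqueDiffOn_box hB p hp).uniqueMDiffWithinAt
  rw [mfderivWithin_comp p hf hc.mdifferentiableWithinAt (mapsTo_cylChart w B) hu,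
    mfderivWithin_eq_mfderiv hu hc]
  rfl

lemma ContMDiffOn.comp_cylChart {f : W × ℝ → N}
    (hf : ContMDiffOn (𝓘(ℝ, E').prod 𝓘(ℝ, ℝ)) J ∞ f (cylinder W)) (w : W) {B : Set E'}
    (hBt : B ⊆ (extChartAt 𝓘(ℝ, E') w).target) :
    ContMDiffOn 𝓘(ℝ, E' × ℝ) J ∞ (f ∘ cylChart w) (box B) :=
  hf.comp ((contMDiffOn_cylChart w).mono (Set.prod_mono hBt (Set.subset_univ _)))
    (mapsTo_cylChart w B)

omit [IsManifold 𝓘(ℝ, E') ∞ W] in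
lemma contMDiffOn_cylinder_of_charts {f : W × ℝ → N}
    (h : ∀ w : W, ∃ B : Set E', IsOpen B ∧ extChartAt 𝓘(ℝ, E') w w ∈ B ∧
      ContMDiffOn 𝓘(ℝ, E' × ℝ) J ∞ (f ∘ cylChart w) (box B)) :
    ContMDiffOn (𝓘(ℝ, E').prod 𝓘(ℝ, ℝ)) J ∞ f (cylinder W) := by
  rintro ⟨w, t⟩ hp
  obtain ⟨B, hB, hwB, hf⟩ := h w
  have hχ : ContMDiffAt (𝓘(ℝ, E').prod 𝓘(ℝ, ℝ)) 𝓘(ℝ, E' × ℝ) ∞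
      (fun q : W × ℝ => (extChartAt 𝓘(ℝ, E') w q.1, q.2)) (w, t) := by
    refine ContMDiffAt.prodMk_space ?_ contMDiffAt_snd
    exact ContMDiffAt.comp (g := extChartAt 𝓘(ℝ, E') w) (w, t) contMDiffAt_extChartAt
      contMDiffAt_fst
  have hnhds : ∀ᶠ q : W × ℝ in 𝓝[cylinder W] (w, t), q.1 ∈ (extChartAt 𝓘(ℝ, E') w).source ∧
      extChartAt 𝓘(ℝ, E') w q.1 ∈ B := by
    have h1 : ∀ᶠ x in 𝓝 w, x ∈ (extChartAt 𝓘(ℝ, E') w).source ∧ extChartAt 𝓘(ℝ, E') w x ∈ B :=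
      Filter.Eventually.and (extChartAt_source_mem_nhds w)
        ((continuousAt_extChartAt w).preimage_mem_nhds (hB.mem_nhds hwB))
    exact nhdsWithin_le_nhds ((continuous_fst.tendsto (w, t)).eventually h1)
  set T : Set (W × ℝ) := {q | q ∈ cylinder W ∧ extChartAt 𝓘(ℝ, E') w q.1 ∈ B} with hT
  have hTn : T ∈ 𝓝[cylinder W] (w, t) := by
    filter_upwards [hnhds, self_mem_nhdsWithin] with q hq hq' using ⟨hq', hq.2⟩
  have h1 : ContMDiffWithinAt (𝓘(ℝ, E').prod 𝓘(ℝ, ℝ)) J ∞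
      ((f ∘ cylChart w) ∘ fun q : W × ℝ => (extChartAt 𝓘(ℝ, E') w q.1, q.2)) T (w, t) :=
    (hf _ ⟨hwB, hp.2⟩).comp (w, t) hχ.contMDiffWithinAt fun q hq => ⟨hq.2, hq.1.2⟩
  have h2 := h1.mono_of_mem_nhdsWithin hTn
  refine h2.congr_of_eventuallyEq ?_ ?_
  · filter_upwards [hnhds] with q hq
    simp only [Function.comp, cylChart]
    rw [(extChartAt 𝓘(ℝ, E') w).left_inv hq.1]
  · simp [Function.comp, cylChart]

end CylinderCharts

end FigureEight

namespace FigureEight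

/-! ### Chain rule through the cylinder -/

section

variable {E₁ H₁ M₁ E₂ H₂ M₂ E₃ H₃ M₃ : Type*}
  [NormedAddCommGroup E₁] [NormedSpace ℝ E₁] [TopologicalSpace H₁] [TopologicalSpace M₁]
  [ChartedSpace H₁ M₁] [NormedAddCommGroup E₂] [NormedSpace ℝ E₂] [TopologicalSpace H₂]
  [TopologicalSpace M₂] [ChartedSpace H₂ M₂] [NormedAddCommGroup E₃] [NormedSpace ℝ E₃]
  [TopologicalSpace H₃] [TopologicalSpace M₃] [ChartedSpace H₃ M₃]
  {I₁ : ModelWithCorners ℝ E₁ H₁} {I₂ : ModelWithCorners ℝ E₂ H₂} {I₃ : ModelWithCorners ℝ E₃ H₃}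

/-- Lets maps that are smooth only on `W × [0,1]` be composed with maps into it, including at the
ends `t = 0, 1`. -/
lemma mfderiv_comp_of_mapsTo {f : M₁ → M₂} {g : M₂ → M₃} {S : Set M₂} {x : M₁}
    (hg : MDifferentiableWithinAt I₂ I₃ g S (f x)) (hf : MDifferentiableAt I₁ I₂ f x)
    (h : ∀ y, f y ∈ S) :
    mfderiv I₁ I₃ (g ∘ f) x = (mfderivWithin I₂ I₃ g S (f x)).comp (mfderiv I₁ I₂ f x) := by
  have := HasMFDerivWithinAt.comp x hg.hasMFDerivWithinAt hf.hasMFDerivAt.hasMFDerivWithinAt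
    (s := Set.univ) fun y _ => h y
  exact (hasMFDerivWithinAt_univ.1 this).mfderiv

end

/-! ### Primitives of `F_t^* θ - F_0^* θ` depending smoothly on `t` -/

section Potential

variable {E V E' W : Type*} [NormedAddCommGroup E] [NormedSpace ℝ E]
  [TopologicalSpace V] [ChartedSpace E V]
  [NormedAddCommGroup E'] [NormedSpace ℝ E']
  [TopologicalSpace W] [ChartedSpace E' W] [IsManifold 𝓘(ℝ, E') ∞ W]

omit [IsManifold 𝓘(ℝ, E') ∞ W] in
lemma mfderiv_slice {E'' H'' N : Type*} [NormedAddCommGroup E''] [NormedSpace ℝ E'']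
    [TopologicalSpace H''] [TopologicalSpace N] [ChartedSpace H'' N]
    {J : ModelWithCorners ℝ E'' H''} {F : W × ℝ → N} {w : W} {t : ℝ}
    (ht : t ∈ Set.Icc (0 : ℝ) 1)
    (hF : MDifferentiableWithinAt (𝓘(ℝ, E').prod 𝓘(ℝ, ℝ)) J F (cylinder W) (w, t))
    (u : TangentSpace 𝓘(ℝ, E') w) :
    mfderiv 𝓘(ℝ, E') J (fun w => F (w, t)) w u =
      mfderivWithin (𝓘(ℝ, E').prod 𝓘(ℝ, ℝ)) J F (cylinder W) (w, t) (u, (0 : ℝ)) := by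
  have h1 : MDifferentiableAt 𝓘(ℝ, E') (𝓘(ℝ, E').prod 𝓘(ℝ, ℝ)) (fun w : W => (w, t)) w :=
    mdifferentiableAt_id.prodMk mdifferentiableAt_const
  have h2 := mfderiv_comp_of_mapsTo (I₁ := 𝓘(ℝ, E')) (f := fun w : W => (w, t)) hF h1
    fun y => ⟨Set.mem_univ _, ht⟩
  change mfderiv 𝓘(ℝ, E') J (F ∘ fun w : W => (w, t)) w u = _
  rw [h2, mfderiv_prod_left]
  rfl

variable [IsManifold 𝓘(ℝ, E) ∞ V] {θ : OneForm 𝓘(ℝ, E) V} {F : W × ℝ → V}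

/-- The pull-back of `θ` under `F`, expressed on `B × [0,1]` by means of the chart at `w`. -/
noncomputable def localForm (θ : OneForm 𝓘(ℝ, E) V) (F : W × ℝ → V) (w : W) (B : Set E') :
    E' × ℝ → E' × ℝ →L[ℝ] ℝ :=
  pullOn θ (F ∘ cylChart w) (box B)

omit [IsManifold 𝓘(ℝ, E) ∞ V] in
lemma localForm_apply (hF : ContMDiffOn (𝓘(ℝ, E').prod 𝓘(ℝ, ℝ)) 𝓘(ℝ, E) ∞ F (cylinder W))
    (w : W) {B : Set E'} (hB : IsOpen B) (hBt : B ⊆ (extChartAt 𝓘(ℝ, E') w).target)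
    {p : E' × ℝ} (hp : p ∈ box B) (u : E' × ℝ) :
    localForm θ F w B p u = θ (F (cylChart w p))
      (mfderivWithin (𝓘(ℝ, E').prod 𝓘(ℝ, ℝ)) 𝓘(ℝ, E) F (cylinder W) (cylChart w p)
        (mfderiv 𝓘(ℝ, E' × ℝ) (𝓘(ℝ, E').prod 𝓘(ℝ, ℝ)) (cylChart w) p u)) := by
  rw [← mfderivWithin_comp_cylChart w hB hBt hp
    ((hF _ (mapsTo_cylChart w B hp)).mdifferentiableWithinAt (by simp))]
  rfl

omit [IsManifold 𝓘(ℝ, E) ∞ V] in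
lemma localForm_apply_horizontal
    (hF : ContMDiffOn (𝓘(ℝ, E').prod 𝓘(ℝ, ℝ)) 𝓘(ℝ, E) ∞ F (cylinder W))
    (w : W) {B : Set E'} (hB : IsOpen B) (hBt : B ⊆ (extChartAt 𝓘(ℝ, E') w).target)
    {y : E'} (hy : y ∈ B) {t : ℝ} (ht : t ∈ Set.Icc (0 : ℝ) 1) (u : E') :
    localForm θ F w B (y, t) (u, 0) =
      θ.pullback 𝓘(ℝ, E') (fun w => F (w, t)) ((extChartAt 𝓘(ℝ, E') w).symm y)
        (mfderiv 𝓘(ℝ, E') 𝓘(ℝ, E') (extChartAt 𝓘(ℝ, E') w).symm y u) := by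
  rw [localForm_apply hF w hB hBt (show (y, t) ∈ box B from ⟨hy, ht⟩), mfderiv_cylChart w (hBt hy)]
  exact congrArg (θ _) (mfderiv_slice ht
    ((hF _ ⟨Set.mem_univ _, ht⟩).mdifferentiableWithinAt (by simp)) _).symm

lemma contDiffOn_localForm (hθ : θ.IsSmooth)
    (hF : ContMDiffOn (𝓘(ℝ, E').prod 𝓘(ℝ, ℝ)) 𝓘(ℝ, E) ∞ F (cylinder W))
    (w : W) {B : Set E'} (hB : IsOpen B) (hBt : B ⊆ (extChartAt 𝓘(ℝ, E') w).target) :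
    ContDiffOn ℝ ∞ (localForm θ F w B) (box B) :=
  contDiffOn_pullOn hθ (uniqueDiffOn_box hB) (ContMDiffOn.comp_cylChart hF w hBt)

lemma fderivWithin_localForm_sub (hθ : θ.IsSmooth)
    (hF : ContMDiffOn (𝓘(ℝ, E').prod 𝓘(ℝ, ℝ)) 𝓘(ℝ, E) ∞ F (cylinder W))
    (w : W) {B : Set E'} (hB : IsOpen B) (hBt : B ⊆ (extChartAt 𝓘(ℝ, E') w).target)
    {p : E' × ℝ} (hp : p ∈ box B) (u v : E' × ℝ) :
    fderivWithin ℝ (localForm θ F w B) (box B) p u v -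
        fderivWithin ℝ (localForm θ F w B) (box B) p v u =
      θ.extDeriv (F (cylChart w p))
        (mfderivWithin (𝓘(ℝ, E').prod 𝓘(ℝ, ℝ)) 𝓘(ℝ, E) F (cylinder W) (cylChart w p)
          (mfderiv 𝓘(ℝ, E' × ℝ) (𝓘(ℝ, E').prod 𝓘(ℝ, ℝ)) (cylChart w) p u))
        (mfderivWithin (𝓘(ℝ, E').prod 𝓘(ℝ, ℝ)) 𝓘(ℝ, E) F (cylinder W) (cylChart w p)
          (mfderiv 𝓘(ℝ, E' × ℝ) (𝓘(ℝ, E').prod 𝓘(ℝ, ℝ)) (cylChart w) p v)) := by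
  have hFp := (hF _ (mapsTo_cylChart w B hp)).mdifferentiableWithinAt (by simp)
  rw [← mfderivWithin_comp_cylChart w hB hBt hp hFp, ← mfderivWithin_comp_cylChart w hB hBt hp hFp]
  exact fderivWithin_pullOn_sub hθ (uniqueDiffOn_box hB) (box_subset_closure_interior hB)
    (ContMDiffOn.comp_cylChart hF w hBt) hp u v

/-- A function with derivative `η` in the chart at `w`. -/
lemma hasFDerivAt_comp_extChartAt_symm {g : W → ℝ} (hg : ContMDiff 𝓘(ℝ, E') 𝓘(ℝ, ℝ) ∞ g) (w : W)
    {y : E'} (hy : y ∈ (extChartAt 𝓘(ℝ, E') w).target) {ℓ : E' →L[ℝ] ℝ}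
    (hℓ : ∀ u : E', ℓ u = mfderiv 𝓘(ℝ, E') 𝓘(ℝ, ℝ) g ((extChartAt 𝓘(ℝ, E') w).symm y)
      (mfderiv 𝓘(ℝ, E') 𝓘(ℝ, E') (extChartAt 𝓘(ℝ, E') w).symm y u)) :
    HasFDerivAt (fun y => g ((extChartAt 𝓘(ℝ, E') w).symm y)) ℓ y := by
  have h1 : MDifferentiableAt 𝓘(ℝ, E') 𝓘(ℝ, E') (extChartAt 𝓘(ℝ, E') w).symm y :=
    ((contMDiffOn_extChartAt_symm (n := ∞) w).contMDiffAt
      ((isOpen_extChartAt_target w).mem_nhds hy)).mdifferentiableAt (by simp)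
  have h2 : MDifferentiableAt 𝓘(ℝ, E') 𝓘(ℝ, ℝ) g ((extChartAt 𝓘(ℝ, E') w).symm y) :=
    hg.mdifferentiableAt (by simp)
  have h3 := (h2.hasMFDerivAt.comp y h1.hasMFDerivAt).hasFDerivAt
  have h4 : ℓ = (mfderiv 𝓘(ℝ, E') 𝓘(ℝ, ℝ) g ((extChartAt 𝓘(ℝ, E') w).symm y)).comp
      (mfderiv 𝓘(ℝ, E') 𝓘(ℝ, E') (extChartAt 𝓘(ℝ, E') w).symm y) := ContinuousLinearMap.ext hℓ
  rw [h4]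
  exact h3

/-- Increments of a family of primitives of `F_t^* θ - F_0^* θ` are smooth in the parameter. -/
lemma contDiffOn_primitive_sub [FiniteDimensional ℝ E'] (hθ : θ.IsSmooth)
    (hF : ContMDiffOn (𝓘(ℝ, E').prod 𝓘(ℝ, ℝ)) 𝓘(ℝ, E) ∞ F (cylinder W)) {g : ℝ → W → ℝ}
    (hgs : ∀ t ∈ Set.Icc (0 : ℝ) 1, ContMDiff 𝓘(ℝ, E') 𝓘(ℝ, ℝ) ∞ (g t))
    (hg : ∀ t ∈ Set.Icc (0 : ℝ) 1, ∀ (x : W) (u : TangentSpace 𝓘(ℝ, E') x),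
      (θ.pullback 𝓘(ℝ, E') (fun w => F (w, t)) - θ.pullback 𝓘(ℝ, E') (fun w => F (w, 0))) x u =
        mfderiv 𝓘(ℝ, E') 𝓘(ℝ, ℝ) (g t) x u)
    (w : W) {B : Set E'} (hB : IsOpen B) (hBc : Convex ℝ B)
    (hBt : B ⊆ (extChartAt 𝓘(ℝ, E') w).target) (hw : extChartAt 𝓘(ℝ, E') w w ∈ B) :
    (∀ t ∈ Set.Icc (0 : ℝ) 1, ∀ y ∈ B,
      HasFDerivAt (fun y => g t ((extChartAt 𝓘(ℝ, E') w).symm y))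
      ((localForm θ F w B (y, t) - localForm θ F w B (y, 0)).comp (.inl ℝ E' ℝ)) y) ∧
    ContDiffOn ℝ ∞ (fun p : E' × ℝ => g p.2 ((extChartAt 𝓘(ℝ, E') w).symm p.1) - g p.2 w)
      (box B) := by
  have h0 : (0 : ℝ) ∈ Set.Icc (0 : ℝ) 1 := ⟨le_rfl, zero_le_one⟩
  have hd : ∀ t ∈ Set.Icc (0 : ℝ) 1, ∀ y ∈ B,
      HasFDerivAt (fun y => g t ((extChartAt 𝓘(ℝ, E') w).symm y))
      ((localForm θ F w B (y, t) - localForm θ F w B (y, 0)).comp (.inl ℝ E' ℝ)) y := by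
    intro t ht y hy
    refine hasFDerivAt_comp_extChartAt_symm (hgs t ht) w (hBt hy) fun u => ?_
    rw [← hg t ht]
    simp only [ContinuousLinearMap.comp_apply, ContinuousLinearMap.inl_apply,
      sub_apply, localForm_apply_horizontal hF w hB hBt hy ht,
      localForm_apply_horizontal hF w hB hBt hy h0]
    rfl
  refine ⟨hd, ?_⟩
  set y₀ := extChartAt 𝓘(ℝ, E') w w with hy₀
  set ζ := localForm θ F w B with hζ
  have hζs : ContDiffOn ℝ ∞ ζ (box B) := contDiffOn_localForm hθ hF w hB hBt
  have hseg : ∀ y ∈ B, ∀ τ ∈ Set.Icc (0 : ℝ) 1, y₀ + τ • (y - y₀) ∈ B := fun y hy τ hτ =>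
    hBc.add_smul_sub_mem hw hy hτ
  -- The increment of a primitive is the integral of the form along the segment from the centre. The
  -- integrand is smooth in `t` although `g t` is chosen separately for each `t`.
  set k : (E' × ℝ) × ℝ → ℝ := fun q =>
    (ζ (y₀ + q.2 • (q.1.1 - y₀), q.1.2) - ζ (y₀ + q.2 • (q.1.1 - y₀), 0)) (q.1.1 - y₀, 0) with hk
  have hks : ContDiffOn ℝ ∞ k (box B ×ˢ Set.Icc (0 : ℝ) 1) := by
    refine ContDiffOn.clm_apply (ContDiffOn.sub ?_ ?_) ?_
    · exact hζs.comp (by fun_prop) fun q hq => ⟨hseg _ hq.1.1 _ hq.2, hq.1.2⟩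
    · exact hζs.comp (by fun_prop) fun q hq => ⟨hseg _ hq.1.1 _ hq.2, h0⟩
    · fun_prop
  refine (contDiffOn_integral_param (convex_box hBc) (uniqueDiffOn_box hB) hks).congr ?_
  rintro ⟨y, t⟩ ⟨hy, ht⟩
  have hline : ∀ τ ∈ Set.uIcc (0 : ℝ) 1,
      HasDerivAt (fun τ : ℝ => g t ((extChartAt 𝓘(ℝ, E') w).symm (y₀ + τ • (y - y₀))))
        (k ((y, t), τ)) τ := by
    intro τ hτ
    rw [Set.uIcc_of_le zero_le_one] at hτ
    have h1 : HasDerivAt (fun τ : ℝ => y₀ + τ • (y - y₀)) (y - y₀) τ := by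
      simpa using ((hasDerivAt_id τ).smul_const (y - y₀)).const_add y₀
    exact (hd t ht _ (hseg y hy τ hτ)).comp_hasDerivAt τ h1
  have hint : IntervalIntegrable (fun τ => k ((y, t), τ)) MeasureTheory.volume 0 1 := by
    refine ContinuousOn.intervalIntegrable_of_Icc zero_le_one ?_
    exact hks.continuousOn.comp (by fun_prop) fun τ hτ =>
      (⟨⟨hy, ht⟩, hτ⟩ : ((y, t), τ) ∈ box B ×ˢ Set.Icc (0 : ℝ) 1)
  rw [intervalIntegral.integral_eq_sub_of_hasDerivAt hline hint]
  simp [hy₀]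

/-- A family of primitives of `F_t^* θ - F_0^* θ` can be chosen to depend smoothly on `t`. -/
lemma exists_smooth_primitive_family [FiniteDimensional ℝ E'] (hθ : θ.IsSmooth)
    (hF : ContMDiffOn (𝓘(ℝ, E').prod 𝓘(ℝ, ℝ)) 𝓘(ℝ, E) ∞ F (cylinder W))
    (hex : ∀ t ∈ Set.Icc (0 : ℝ) 1, OneForm.IsExact
      (θ.pullback 𝓘(ℝ, E') (fun w => F (w, t)) - θ.pullback 𝓘(ℝ, E') (fun w => F (w, 0)))) :
    ∃ g : W × ℝ → ℝ, ∀ w : W, ∃ B : Set E', IsOpen B ∧ extChartAt 𝓘(ℝ, E') w w ∈ B ∧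
      B ⊆ (extChartAt 𝓘(ℝ, E') w).target ∧ ContDiffOn ℝ ∞ (g ∘ cylChart w) (box B) ∧
      ∀ y ∈ B, ∀ t ∈ Set.Icc (0 : ℝ) 1, ∀ u : E',
        fderivWithin ℝ (g ∘ cylChart w) (box B) (y, t) (u, 0) =
          localForm θ F w B (y, t) (u, 0) - localForm θ F w B (y, 0) (u, 0) := by
  classical
  have hex' : ∀ t : ℝ, ∃ g : W → ℝ, t ∈ Set.Icc (0 : ℝ) 1 →
      ContMDiff 𝓘(ℝ, E') 𝓘(ℝ, ℝ) ∞ g ∧ ∀ (x : W) (u : TangentSpace 𝓘(ℝ, E') x),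
      (θ.pullback 𝓘(ℝ, E') (fun w => F (w, t)) - θ.pullback 𝓘(ℝ, E') (fun w => F (w, 0))) x u =
        mfderiv 𝓘(ℝ, E') 𝓘(ℝ, ℝ) g x u := by
    intro t
    by_cases ht : t ∈ Set.Icc (0 : ℝ) 1
    · obtain ⟨g, h1, h2⟩ := hex t ht
      exact ⟨g, fun _ => ⟨h1, h2⟩⟩
    · exact ⟨0, fun h => absurd h ht⟩
  choose g hg using hex'
  have hgs := fun t ht => (hg t ht).1
  have hgd := fun t ht => (hg t ht).2
  -- Each `g t` is determined only up to a locally constant function; subtracting its value at one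
  -- point of each component removes the arbitrary dependence on `t`.
  let base : W → W := fun w => (Quotient.out (ConnectedComponents.mk w) : W)
  have hbase : ∀ w, ConnectedComponents.mk (base w) = ConnectedComponents.mk w :=
    fun w => Quotient.out_eq _
  choose r hr hrt using fun w : W => exists_chart_ball (E' := E') w
  have hloc := fun w : W => contDiffOn_primitive_sub hθ hF hgs hgd w Metric.isOpen_ball
    (convex_ball _ _) (hrt w) (Metric.mem_ball_self (hr w))
  -- Smoothness in `t` of the increment between two points holds for nearby points and is symmetric
  -- and transitive, so it spreads over a whole component.
  have hrel : ∀ x y : W, x ∈ connectedComponent y →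
      ContDiffOn ℝ ∞ (fun t => g t x - g t y) (Set.Icc (0 : ℝ) 1) := by
    intro x y hx
    refine isPreconnected_connectedComponent.induction₂
      (fun a b => ContDiffOn ℝ ∞ (fun t => g t a - g t b) (Set.Icc (0 : ℝ) 1))
      ?_ ?_ ?_ hx mem_connectedComponent
    · intro w _
      have h1 : ∀ᶠ z in 𝓝 w, z ∈ (extChartAt 𝓘(ℝ, E') w).source ∧
          extChartAt 𝓘(ℝ, E') w z ∈ Metric.ball (extChartAt 𝓘(ℝ, E') w w) (r w) :=
        Filter.Eventually.and (extChartAt_source_mem_nhds w)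
          ((continuousAt_extChartAt w).preimage_mem_nhds (Metric.ball_mem_nhds _ (hr w)))
      refine nhdsWithin_le_nhds (h1.mono fun z hz => ?_)
      have h2 := (hloc w).2.comp (s := Set.Icc (0 : ℝ) 1)
        (f := fun t : ℝ => (extChartAt 𝓘(ℝ, E') w z, t)) (by fun_prop) fun t ht => ⟨hz.2, ht⟩
      refine h2.neg.congr fun t _ => ?_
      simp only [Function.comp, (extChartAt 𝓘(ℝ, E') w).left_inv hz.1]
      ring
    · intro a b c _ _ _ h1 h2
      exact (h1.add h2).congr fun t _ => by simp
    · intro a b _ _ h1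
      exact h1.neg.congr fun t _ => by simp
  refine ⟨fun q => g q.2 q.1 - g q.2 (base q.1), fun w => ⟨_, Metric.isOpen_ball,
    Metric.mem_ball_self (hr w), hrt w, ?_⟩⟩
  set B := Metric.ball (extChartAt 𝓘(ℝ, E') w w) (r w) with hB
  -- A chart ball is connected, so a single base point serves all of it.
  have hcomp : ∀ y ∈ B, base ((extChartAt 𝓘(ℝ, E') w).symm y) = base w := by
    intro y hy
    have h1 : IsPreconnected ((extChartAt 𝓘(ℝ, E') w).symm '' B) :=
      (convex_ball _ _).isPreconnected.image _ ((continuousOn_extChartAt_symm w).mono (hrt w))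
    have h2 := h1.subset_connectedComponent
      (⟨_, Metric.mem_ball_self (hr w), extChartAt_to_inv w⟩ :
        w ∈ (extChartAt 𝓘(ℝ, E') w).symm '' B) ⟨y, hy, rfl⟩
    have h3 : ConnectedComponents.mk ((extChartAt 𝓘(ℝ, E') w).symm y) =
        ConnectedComponents.mk w :=
      ConnectedComponents.coe_eq_coe'.2 h2
    simp only [base, h3]
  have hexp : ∀ p ∈ box B, ((fun q : W × ℝ => g q.2 q.1 - g q.2 (base q.1)) ∘ cylChart w) p =
      (g p.2 ((extChartAt 𝓘(ℝ, E') w).symm p.1) - g p.2 w) + (g p.2 w - g p.2 (base w)) := by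
    intro p hp
    simp only [Function.comp, cylChart, hcomp p.1 hp.1]
    ring
  have hsm : ContDiffOn ℝ ∞ ((fun q : W × ℝ => g q.2 q.1 - g q.2 (base q.1)) ∘ cylChart w)
      (box B) := by
    have hwb : w ∈ connectedComponent (base w) := ConnectedComponents.coe_eq_coe'.1 (hbase w).symm
    exact ((hloc w).2.add ((hrel w (base w) hwb).comp (f := fun p : E' × ℝ => p.2)
      contDiff_snd.contDiffOn fun p hp => hp.2)).congr hexp
  refine ⟨hsm, fun y hy t ht u => ?_⟩
  have hp : (y, t) ∈ box B := ⟨hy, ht⟩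
  have h1 := ((hsm.differentiableOn (by simp)) (y, t) hp).hasFDerivWithinAt
  have h2 : HasFDerivWithinAt (fun y : E' => (y, t)) (ContinuousLinearMap.inl ℝ E' ℝ) B y :=
    (hasFDerivAt_prodMk_left y t).hasFDerivWithinAt
  have h3 := HasFDerivWithinAt.comp (t := box B) y h1 h2 fun x hx => ⟨hx, ht⟩
  have h4 := ((hloc w).1 t ht y hy).hasFDerivWithinAt (s := B) |>.sub_const (g t (base w))
  have h5 := h4.congr (f₁ := ((fun q : W × ℝ => g q.2 q.1 - g q.2 (base q.1)) ∘ cylChart w) ∘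
    fun y : E' => (y, t)) (fun x hx => by simp only [Function.comp, cylChart, hcomp x hx])
    (by simp only [Function.comp, cylChart, hcomp y hy])
  have h6 := (Metric.isOpen_ball.uniqueDiffOn y hy).eq h3 h5
  exact DFunLike.congr_fun h6 u

end Potential

end FigureEight

namespace FigureEight

/-! ### Existence of a potential, and the homotopy formula -/

section Primitives

variable {E V E' W : Type*} [NormedAddCommGroup E] [NormedSpace ℝ E]
  [TopologicalSpace V] [ChartedSpace E V] [IsManifold 𝓘(ℝ, E) ∞ V]
  [NormedAddCommGroup E'] [NormedSpace ℝ E']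
  [TopologicalSpace W] [ChartedSpace E' W] [IsManifold 𝓘(ℝ, E') ∞ W]
  {θ : OneForm 𝓘(ℝ, E) V} {F : W × ℝ → V}

/-- The derivative in the direction of `[0,1]` of a function on the cylinder. -/
noncomputable def timeDeriv (E' : Type*) {W : Type*} [NormedAddCommGroup E'] [NormedSpace ℝ E']
    [TopologicalSpace W] [ChartedSpace E' W] (g : W × ℝ → ℝ) (p : W × ℝ) : ℝ :=
  mfderivWithin (𝓘(ℝ, E').prod 𝓘(ℝ, ℝ)) 𝓘(ℝ, ℝ) g (cylinder W) p ((0 : E'), (1 : ℝ))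

lemma fderivWithin_comp_cylChart (w : W) {B : Set E'} (hB : IsOpen B)
    (hBt : B ⊆ (extChartAt 𝓘(ℝ, E') w).target) {f : W × ℝ → ℝ} {p : E' × ℝ} (hp : p ∈ box B)
    (hf : ContMDiffOn (𝓘(ℝ, E').prod 𝓘(ℝ, ℝ)) 𝓘(ℝ, ℝ) ∞ f (cylinder W)) (u : E' × ℝ) :
    fderivWithin ℝ (f ∘ cylChart w) (box B) p u =
      mfderivWithin (𝓘(ℝ, E').prod 𝓘(ℝ, ℝ)) 𝓘(ℝ, ℝ) f (cylinder W) (cylChart w p)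
        (mfderiv 𝓘(ℝ, E' × ℝ) (𝓘(ℝ, E').prod 𝓘(ℝ, ℝ)) (cylChart w) p u) := by
  have h := mfderivWithin_comp_cylChart w hB hBt hp
    ((hf _ (mapsTo_cylChart w B hp)).mdifferentiableWithinAt (by simp)) u
  rw [mfderivWithin_eq_fderivWithin] at h
  exact h

lemma mfderiv_cylChart_vertical (w : W) {p : E' × ℝ}
    (hp : p.1 ∈ (extChartAt 𝓘(ℝ, E') w).target) :
    mfderiv 𝓘(ℝ, E' × ℝ) (𝓘(ℝ, E').prod 𝓘(ℝ, ℝ)) (cylChart w) p ((0 : E'), (1 : ℝ)) =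
      ((0 : E'), (1 : ℝ)) := by
  rw [mfderiv_cylChart w hp]
  exact Prod.ext (map_zero _) rfl

/-- `localForm` is isotropic in the horizontal directions. -/
lemma fderivWithin_localForm_horizontal (hθ : θ.IsSmooth)
    (hF : IsExactLagrangianIsotopy (E' := E') θ F) (w : W) {B : Set E'} (hB : IsOpen B)
    (hBt : B ⊆ (extChartAt 𝓘(ℝ, E') w).target) {p : E' × ℝ} (hp : p ∈ box B) (u v : E') :
    fderivWithin ℝ (localForm θ F w B) (box B) p (u, 0) (v, 0) =
      fderivWithin ℝ (localForm θ F w B) (box B) p (v, 0) (u, 0) := by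
  rw [← sub_eq_zero, fderivWithin_localForm_sub hθ hF.smooth w hB hBt hp,
    mfderiv_cylChart w (hBt hp.1), mfderiv_cylChart w (hBt hp.1)]
  have hFp := (hF.smooth _ (mapsTo_cylChart w B hp)).mdifferentiableWithinAt (by simp)
  have h := (hF.lagrangian p.2 hp.2).isotropic ((extChartAt 𝓘(ℝ, E') w).symm p.1)
    (mfderiv 𝓘(ℝ, E') 𝓘(ℝ, E') (extChartAt 𝓘(ℝ, E') w).symm p.1 u)
    (mfderiv 𝓘(ℝ, E') 𝓘(ℝ, E') (extChartAt 𝓘(ℝ, E') w).symm p.1 v)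
  rw [mfderiv_slice hp.2 hFp, mfderiv_slice hp.2 hFp] at h
  exact h

/-- The defining equation of a potential, in the charts of the cylinder. -/
lemma isPotential_iff_charts {ψ : W × ℝ → ℝ} (hθ : θ.IsSmooth)
    (hF : ContMDiffOn (𝓘(ℝ, E').prod 𝓘(ℝ, ℝ)) 𝓘(ℝ, E) ∞ F (cylinder W))
    (hψ : ContMDiffOn (𝓘(ℝ, E').prod 𝓘(ℝ, ℝ)) 𝓘(ℝ, ℝ) ∞ ψ (cylinder W)) (w : W) {B : Set E'}
    (hB : IsOpen B) (hBt : B ⊆ (extChartAt 𝓘(ℝ, E') w).target) {p : E' × ℝ} (hp : p ∈ box B) :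
    (∀ u v : TangentSpace (𝓘(ℝ, E').prod 𝓘(ℝ, ℝ)) (cylChart w p),
      let DF := mfderivWithin (𝓘(ℝ, E').prod 𝓘(ℝ, ℝ)) 𝓘(ℝ, E) F (cylinder W) (cylChart w p)
      let dψ : TangentSpace (𝓘(ℝ, E').prod 𝓘(ℝ, ℝ)) (cylChart w p) → ℝ := fun a =>
        mfderivWithin (𝓘(ℝ, E').prod 𝓘(ℝ, ℝ)) 𝓘(ℝ, ℝ) ψ (cylinder W) (cylChart w p) a
      let dt : TangentSpace (𝓘(ℝ, E').prod 𝓘(ℝ, ℝ)) (cylChart w p) → ℝ := fun a =>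
        mfderiv (𝓘(ℝ, E').prod 𝓘(ℝ, ℝ)) 𝓘(ℝ, ℝ) Prod.snd (cylChart w p) a
      θ.extDeriv (F (cylChart w p)) (DF u) (DF v) = -(dψ u * dt v - dψ v * dt u)) ↔
    ∀ u v : E' × ℝ, fderivWithin ℝ (localForm θ F w B) (box B) p u v -
        fderivWithin ℝ (localForm θ F w B) (box B) p v u =
      -(fderivWithin ℝ (ψ ∘ cylChart w) (box B) p u * v.2 -
        fderivWithin ℝ (ψ ∘ cylChart w) (box B) p v * u.2) := by
  have h1 : ∀ u : E' × ℝ, (mfderivWithin (𝓘(ℝ, E').prod 𝓘(ℝ, ℝ)) 𝓘(ℝ, ℝ) ψ (cylinder W)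
      (cylChart w p) (mfderiv 𝓘(ℝ, E' × ℝ) (𝓘(ℝ, E').prod 𝓘(ℝ, ℝ)) (cylChart w) p u) : ℝ) =
      fderivWithin ℝ (ψ ∘ cylChart w) (box B) p u := fun u =>
    (fderivWithin_comp_cylChart w hB hBt hp hψ u).symm
  have h2 : ∀ u : E' × ℝ, (mfderiv (𝓘(ℝ, E').prod 𝓘(ℝ, ℝ)) 𝓘(ℝ, ℝ) Prod.snd
      (cylChart w p) (mfderiv 𝓘(ℝ, E' × ℝ) (𝓘(ℝ, E').prod 𝓘(ℝ, ℝ)) (cylChart w) p u) : ℝ) =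
      u.2 := by
    intro u
    rw [mfderiv_snd, mfderiv_cylChart w (hBt hp.1)]
    rfl
  constructor
  · intro h u v
    rw [fderivWithin_localForm_sub hθ hF w hB hBt hp]
    have h3 := h (mfderiv 𝓘(ℝ, E' × ℝ) (𝓘(ℝ, E').prod 𝓘(ℝ, ℝ)) (cylChart w) p u)
      (mfderiv 𝓘(ℝ, E' × ℝ) (𝓘(ℝ, E').prod 𝓘(ℝ, ℝ)) (cylChart w) p v)
    simp only [h1, h2] at h3
    exact h3
  · intro h u v
    obtain ⟨u, rfl⟩ := mfderiv_cylChart_surjective w (hBt hp.1) u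
    obtain ⟨v, rfl⟩ := mfderiv_cylChart_surjective w (hBt hp.1) v
    simp only [h1, h2]
    exact (fderivWithin_localForm_sub hθ hF w hB hBt hp u v).symm.trans (h u v)

/-- An exact Lagrangian isotopy has a potential. -/
lemma exists_isPotential [FiniteDimensional ℝ E'] (hθ : θ.IsSmooth)
    (hF : IsExactLagrangianIsotopy (E' := E') θ F) :
    ∃ ψ : W × ℝ → ℝ, IsPotential (E' := E') θ.extDeriv F ψ := by
  obtain ⟨g, hg⟩ := exists_smooth_primitive_family hθ hF.smooth hF.exact
  choose B hB hwB hBt hgs hgd using hg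
  have hgc : ContMDiffOn (𝓘(ℝ, E').prod 𝓘(ℝ, ℝ)) 𝓘(ℝ, ℝ) ∞ g (cylinder W) :=
    contMDiffOn_cylinder_of_charts fun w => ⟨B w, hB w, hwB w, (hgs w).contMDiffOn⟩
  -- For `ζ = ζ_t + f dt` the mixed part of `dζ` is `dt ∧ ∂_t ζ_t + d_W f ∧ dt`. Since `∂_t ζ_t =
  -- d_W ∂_t g`, it equals `-d_W(∂_t g - f) ∧ dt`, whence this choice of `ψ`.
  set ψ : W × ℝ → ℝ := fun p =>
    timeDeriv E' g p -
      θ (F p) (mfderivWithin (𝓘(ℝ, E').prod 𝓘(ℝ, ℝ)) 𝓘(ℝ, E) F (cylinder W) p ((0 : E'), (1 : ℝ)))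
    with hψ
  have hψc : ∀ w : W, ∀ p ∈ box (B w), (ψ ∘ cylChart w) p =
      fderivWithin ℝ (g ∘ cylChart w) (box (B w)) p (0, 1) -
        localForm θ F w (B w) p (0, 1) := by
    intro w p hp
    rw [localForm_apply hF.smooth w (hB w) (hBt w) hp,
      fderivWithin_comp_cylChart w (hB w) (hBt w) hp hgc,
      mfderiv_cylChart_vertical w (hBt w hp.1)]
    rfl
  have hζs := fun w => contDiffOn_localForm hθ hF.smooth w (hB w) (hBt w)
  have hDg := fun w => (hgs w).fderivWithin (m := ∞) (uniqueDiffOn_box (hB w)) (by simp)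
  have hψs : ContMDiffOn (𝓘(ℝ, E').prod 𝓘(ℝ, ℝ)) 𝓘(ℝ, ℝ) ∞ ψ (cylinder W) := by
    refine contMDiffOn_cylinder_of_charts fun w => ⟨B w, hB w, hwB w, ?_⟩
    refine ContDiffOn.contMDiffOn (ContDiffOn.congr ?_ (hψc w))
    exact ((hDg w).clm_apply contDiffOn_const).sub ((hζs w).clm_apply contDiffOn_const)
  refine ⟨ψ, hψs, ?_⟩
  rintro ⟨w, t⟩ hwt
  have hp : (extChartAt 𝓘(ℝ, E') w w, t) ∈ box (B w) := ⟨hwB w, hwt.2⟩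
  rw [← cylChart_extChartAt (E' := E') w t]
  refine (isPotential_iff_charts hθ hF.smooth hψs w (hB w) (hBt w) hp).2 ?_
  generalize (extChartAt 𝓘(ℝ, E') w w, t) = p at hp
  have hu := uniqueDiffOn_box (hB w) p hp
  set ζ := localForm θ F w (B w) with hζ
  set D := fderivWithin ℝ ζ (box (B w)) p with hD
  have hζd : HasFDerivWithinAt ζ D (box (B w)) p :=
    ((hζs w).differentiableOn (by simp) p hp).hasFDerivWithinAt
  set D2 := fderivWithin ℝ (fderivWithin ℝ (g ∘ cylChart w) (box (B w))) (box (B w)) p with hD2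
  have hDgd : HasFDerivWithinAt (fderivWithin ℝ (g ∘ cylChart w) (box (B w))) D2 (box (B w)) p :=
    ((hDg w).differentiableOn (by simp) p hp).hasFDerivWithinAt
  have hψd : ∀ u, fderivWithin ℝ (ψ ∘ cylChart w) (box (B w)) p u = D2 u (0, 1) - D u (0, 1) := by
    intro u
    have h1 := (hDgd.clm_apply (hasFDerivWithinAt_const ((0 : E'), (1 : ℝ)) p (box (B w)))).sub
      (hζd.clm_apply (hasFDerivWithinAt_const ((0 : E'), (1 : ℝ)) p (box (B w))))
    have h2 := h1.congr (hψc w) (hψc w p hp)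
    rw [h2.fderivWithin hu]
    simp
  have hsymm : IsSymmSndFDerivWithinAt ℝ (g ∘ cylChart w) (box (B w)) p :=
    (hgs w p hp).isSymmSndFDerivWithinAt
      (by rw [minSmoothness_of_isRCLikeNormedField]; exact WithTop.coe_le_coe.2 le_top)
      (uniqueDiffOn_box (hB w)) (box_subset_closure_interior (hB w) hp) hp
  -- Mixed partial derivatives of `g` commute, and differentiating `d_W g = ζ_t - ζ_0` in `t`
  -- removes the constant term `ζ_0`.
  have hvert : ∀ u : E', D2 (u, 0) (0, 1) = D (0, 1) (u, 0) := by
    intro u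
    rw [hsymm.eq]
    have h1 := hDgd.clm_apply (hasFDerivWithinAt_const (u, (0 : ℝ)) p (box (B w)))
    have h0 : (p.1, (0 : ℝ)) ∈ box (B w) := ⟨hp.1, le_rfl, zero_le_one⟩
    have hζ0 : HasFDerivWithinAt ζ (fderivWithin ℝ ζ (box (B w)) (p.1, 0)) (box (B w)) (p.1, 0) :=
      ((hζs w).differentiableOn (by simp) _ h0).hasFDerivWithinAt
    have hpr : HasFDerivWithinAt (fun q : E' × ℝ => (q.1, (0 : ℝ)))
        ((ContinuousLinearMap.fst ℝ E' ℝ).prod 0) (box (B w)) p :=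
      hasFDerivWithinAt_fst.prodMk (hasFDerivWithinAt_const _ _ _)
    have h2 := HasFDerivWithinAt.comp (t := box (B w)) p hζ0 hpr
      fun q hq => ⟨hq.1, le_rfl, zero_le_one⟩
    have h3 := (hζd.clm_apply (hasFDerivWithinAt_const (u, (0 : ℝ)) p (box (B w)))).sub
      (h2.clm_apply (hasFDerivWithinAt_const (u, (0 : ℝ)) p (box (B w))))
    have h4 := h3.congr (f₁ := fun q => fderivWithin ℝ (g ∘ cylChart w) (box (B w)) q (u, 0))
      (fun q hq => hgd w q.1 hq.1 q.2 hq.2 u) (hgd w p.1 hp.1 p.2 hp.2 u)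
    have h5 := DFunLike.congr_fun (hu.eq h1 h4) ((0 : E'), (1 : ℝ))
    simpa [Prod.mk_zero_zero] using h5
  have hhor : ∀ u v : E', D (u, 0) (v, 0) = D (v, 0) (u, 0) :=
    fderivWithin_localForm_horizontal hθ hF w (hB w) (hBt w) hp
  have hsplit : ∀ u : E' × ℝ, u = (u.1, (0 : ℝ)) + u.2 • ((0 : E'), (1 : ℝ)) := fun u => by
    ext <;> simp
  intro u v
  rw [hψd, hψd, hsplit u, hsplit v]
  have e1 := hvert u.1
  have e2 := hvert v.1
  have e3 := hhor u.1 v.1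
  simp only [map_add, map_smul, add_apply, smul_apply,
    smul_eq_mul, Prod.snd_add, Prod.smul_snd, mul_one, zero_add, e1, e2, e3]
  ring

/-- The homotopy formula: `F^* θ + ψ dt` has a primitive on the cylinder extending a given
primitive of `F_0^* θ`. -/
lemma exists_primitive_cylinder (hθ : θ.IsSmooth)
    (hF : ContMDiffOn (𝓘(ℝ, E').prod 𝓘(ℝ, ℝ)) 𝓘(ℝ, E) ∞ F (cylinder W))
    (h0 : OneForm.IsExact (θ.pullback 𝓘(ℝ, E') (fun w => F (w, 0))))
    {ψ : W × ℝ → ℝ} (hψ : IsPotential (E' := E') θ.extDeriv F ψ) :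
    ∃ G : W × ℝ → ℝ, ContMDiffOn (𝓘(ℝ, E').prod 𝓘(ℝ, ℝ)) 𝓘(ℝ, ℝ) ∞ G (cylinder W) ∧
      ∀ p ∈ cylinder W, ∀ u : TangentSpace (𝓘(ℝ, E').prod 𝓘(ℝ, ℝ)) p,
        (mfderivWithin (𝓘(ℝ, E').prod 𝓘(ℝ, ℝ)) 𝓘(ℝ, ℝ) G (cylinder W) p u : ℝ) =
          θ (F p) (mfderivWithin (𝓘(ℝ, E').prod 𝓘(ℝ, ℝ)) 𝓘(ℝ, E) F (cylinder W) p u) +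
            ψ p * u.2 := by
  obtain ⟨g₀, hg₀s, hg₀⟩ := h0
  -- Integrating along the time lines defines `G` globally, so local primitives need not be glued.
  set G : W × ℝ → ℝ := fun q => g₀ q.1 + ∫ τ in (0 : ℝ)..q.2,
    (θ (F (q.1, τ)) (mfderivWithin (𝓘(ℝ, E').prod 𝓘(ℝ, ℝ)) 𝓘(ℝ, E) F (cylinder W) (q.1, τ)
      ((0 : E'), (1 : ℝ))) + ψ (q.1, τ)) with hG
  choose r hr hrt using fun w : W => exists_chart_ball (E' := E') w
  have h00 : (0 : ℝ) ∈ Set.Icc (0 : ℝ) 1 := ⟨le_rfl, zero_le_one⟩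
  have key : ∀ w : W, ∀ p ∈ box (Metric.ball (extChartAt 𝓘(ℝ, E') w w) (r w)),
      HasFDerivWithinAt (G ∘ cylChart w)
        (localForm θ F w (Metric.ball (extChartAt 𝓘(ℝ, E') w w) (r w)) p +
          ψ (cylChart w p) • ContinuousLinearMap.snd ℝ E' ℝ)
        (box (Metric.ball (extChartAt 𝓘(ℝ, E') w w) (r w))) p := by
    intro w
    have hwB := Metric.mem_ball_self (x := extChartAt 𝓘(ℝ, E') w w) (hr w)
    have hBt := hrt w
    have hB : IsOpen (Metric.ball (extChartAt 𝓘(ℝ, E') w w) (r w)) := Metric.isOpen_ball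
    have hBc : Convex ℝ (Metric.ball (extChartAt 𝓘(ℝ, E') w w) (r w)) := convex_ball _ _
    generalize Metric.ball (extChartAt 𝓘(ℝ, E') w w) (r w) = B at *
    set ζ := localForm θ F w B with hζ
    have hζs : ContDiffOn ℝ ∞ ζ (box B) := contDiffOn_localForm hθ hF w hB hBt
    have hψs : ContDiffOn ℝ ∞ (ψ ∘ cylChart w) (box B) :=
      (ContMDiffOn.comp_cylChart hψ.smooth w hBt).contDiffOn
    set ξ : E' × ℝ → E' × ℝ →L[ℝ] ℝ := fun p =>
      ζ p + (ψ ∘ cylChart w) p • ContinuousLinearMap.snd ℝ E' ℝ with hξ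
    have hξs : ContDiffOn ℝ ∞ ξ (box B) := hζs.add (hψs.smul contDiffOn_const)
    -- Poincaré lemma on a convex box: the potential equation says exactly that `ξ`, the local form
    -- of `F^* θ + ψ dt`, is closed.
    obtain ⟨K, hK⟩ := (convex_box hBc).exists_forall_hasFDerivWithinAt_of_fderivWithin_symmetric
      (hξs.differentiableOn (by simp)) (by
        intro p hp u _ v _
        have hd := (((hζs.differentiableOn (by simp)) p hp).hasFDerivWithinAt).add
          ((((hψs.differentiableOn (by simp)) p hp).hasFDerivWithinAt).smul_const
            (ContinuousLinearMap.snd ℝ E' ℝ))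
        have hd' : HasFDerivWithinAt ξ _ (box B) p := hd
        rw [hd'.fderivWithin (uniqueDiffOn_box hB p hp)]
        have h1 := (isPotential_iff_charts hθ hF hψ.smooth w hB hBt hp).1
          (hψ.eq _ (mapsTo_cylChart w B hp)) u v
        simp
        linarith)
    -- `K` and `G` agree up to a constant
    have hK0 : ∀ y ∈ B, HasFDerivAt (fun y => K (y, 0) - g₀ ((extChartAt 𝓘(ℝ, E') w).symm y))
        (0 : E' →L[ℝ] ℝ) y := by
      intro y hy
      have h1 : HasFDerivAt (fun y : E' => K (y, 0)) ((ξ (y, 0)).comp (.inl ℝ E' ℝ)) y :=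
        (HasFDerivWithinAt.comp (t := box B) y (hK (y, 0) ⟨hy, h00⟩)
          (hasFDerivAt_prodMk_left y (0 : ℝ)).hasFDerivWithinAt
          fun z hz => (⟨hz, h00⟩ : (z, (0 : ℝ)) ∈ box B)).hasFDerivAt (hB.mem_nhds hy)
      have h2 : HasFDerivAt (fun y => g₀ ((extChartAt 𝓘(ℝ, E') w).symm y))
          ((ξ (y, 0)).comp (.inl ℝ E' ℝ)) y := by
        refine hasFDerivAt_comp_extChartAt_symm hg₀s w (hBt hy) fun u => ?_
        rw [← hg₀]
        have h3 := localForm_apply_horizontal (θ := θ) hF w hB hBt hy h00 u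
        simp only [hξ, ContinuousLinearMap.comp_apply, ContinuousLinearMap.inl_apply, add_apply,
          smul_apply, ContinuousLinearMap.coe_snd', smul_zero, add_zero]
        exact h3
      exact (sub_self ((ξ (y, 0)).comp (.inl ℝ E' ℝ))) ▸ h1.sub h2
    have hconst : ∀ y ∈ B, K (y, 0) - g₀ ((extChartAt 𝓘(ℝ, E') w).symm y) =
        K (extChartAt 𝓘(ℝ, E') w w, 0) - g₀ w := by
      intro y hy
      have h1 := hBc.is_const_of_fderivWithin_eq_zero (𝕜 := ℝ)
        (f := fun y => K (y, 0) - g₀ ((extChartAt 𝓘(ℝ, E') w).symm y))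
        (fun z hz => (hK0 z hz).differentiableAt.differentiableWithinAt)
        (fun z hz => ((hK0 z hz).hasFDerivWithinAt).fderivWithin (hB.uniqueDiffOn z hz)) hy hwB
      simpa using h1
    have hGK : ∀ p ∈ box B, (G ∘ cylChart w) p =
        K p - (K (extChartAt 𝓘(ℝ, E') w w, 0) - g₀ w) := by
      rintro ⟨y, t⟩ ⟨hy, ht⟩
      have hIcc : Set.Icc (0 : ℝ) t ⊆ Set.Icc 0 1 := Set.Icc_subset_Icc_right ht.2
      have hKy : ∀ τ ∈ Set.Icc (0 : ℝ) 1,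
          HasDerivWithinAt (fun τ => K (y, τ)) (ξ (y, τ) (0, 1)) (Set.Icc 0 1) τ := by
        intro τ hτ
        have h1 : HasDerivWithinAt (fun τ : ℝ => (y, τ)) ((0 : E'), (1 : ℝ)) (Set.Icc 0 1) τ :=
          (hasDerivWithinAt_const _ _ _).prodMk (hasDerivWithinAt_id _ _)
        exact HasFDerivWithinAt.comp_hasDerivWithinAt (t := box B) τ (hK (y, τ) ⟨hy, hτ⟩) h1
          fun z hz => ⟨hy, hz⟩
      have hcont : ContinuousOn (fun τ => ξ (y, τ) ((0 : E'), (1 : ℝ))) (Set.Icc 0 1) :=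
        (hξs.continuousOn.comp (by fun_prop) fun τ hτ =>
          (⟨hy, hτ⟩ : (y, τ) ∈ box B)).clm_apply continuousOn_const
      have hFTC := intervalIntegral.integral_eq_sub_of_hasDerivAt_of_le ht.1
        (f := fun τ => K (y, τ)) (f' := fun τ => ξ (y, τ) (0, 1))
        (fun τ hτ => ((hKy τ (hIcc hτ)).continuousWithinAt).mono hIcc)
        (fun τ hτ => (hKy τ (hIcc ⟨hτ.1.le, hτ.2.le⟩)).hasDerivAt
          (Icc_mem_nhds hτ.1 (hτ.2.trans_le ht.2)))
        ((hcont.mono hIcc).intervalIntegrable_of_Icc ht.1)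
      have hint : ∫ τ in (0 : ℝ)..t, (θ (F (cylChart w (y, τ)))
          (mfderivWithin (𝓘(ℝ, E').prod 𝓘(ℝ, ℝ)) 𝓘(ℝ, E) F (cylinder W) (cylChart w (y, τ))
          ((0 : E'), (1 : ℝ))) + ψ (cylChart w (y, τ))) = ∫ τ in (0 : ℝ)..t, ξ (y, τ) (0, 1) := by
        refine intervalIntegral.integral_congr fun τ hτ => ?_
        rw [Set.uIcc_of_le ht.1] at hτ
        have h2 := localForm_apply (θ := θ) hF w hB hBt
          (show (y, τ) ∈ box B from ⟨hy, hIcc hτ⟩) ((0 : E'), (1 : ℝ))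
        rw [mfderiv_cylChart_vertical (p := (y, τ)) w (hBt hy)] at h2
        simp only [hξ, add_apply, smul_apply, hζ, h2, ContinuousLinearMap.coe_snd', smul_eq_mul,
          mul_one, Function.comp]
      have h3 := hconst y hy
      have h4 : (G ∘ cylChart w) (y, t) =
          g₀ ((extChartAt 𝓘(ℝ, E') w).symm y) + (K (y, t) - K (y, 0)) := by
        rw [← hFTC, ← hint]
        rfl
      rw [h4]
      linarith
    intro p hp
    exact ((hK p hp).sub_const _).congr hGK (hGK p hp)
  -- The derivative found in `key` is itself smooth, hence so is `G`.
  have hGs : ∀ w : W, ContDiffOn ℝ ∞ (G ∘ cylChart w)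
      (box (Metric.ball (extChartAt 𝓘(ℝ, E') w w) (r w))) := by
    intro w
    have hu := uniqueDiffOn_box (Metric.isOpen_ball (x := extChartAt 𝓘(ℝ, E') w w) (ε := r w))
    refine (contDiffOn_infty_iff_fderivWithin hu).2
      ⟨fun p hp => (key w p hp).differentiableWithinAt, ?_⟩
    refine ContDiffOn.congr ?_ fun p hp => (key w p hp).fderivWithin (hu p hp)
    exact (contDiffOn_localForm hθ hF w Metric.isOpen_ball (hrt w)).add
      ((ContMDiffOn.comp_cylChart hψ.smooth w (hrt w)).contDiffOn.smul contDiffOn_const)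
  have hGc : ContMDiffOn (𝓘(ℝ, E').prod 𝓘(ℝ, ℝ)) 𝓘(ℝ, ℝ) ∞ G (cylinder W) :=
    contMDiffOn_cylinder_of_charts fun w =>
      ⟨_, Metric.isOpen_ball, Metric.mem_ball_self (hr w), (hGs w).contMDiffOn⟩
  refine ⟨G, hGc, ?_⟩
  rintro ⟨w, t⟩ hwt
  have hp : (extChartAt 𝓘(ℝ, E') w w, t) ∈ box (Metric.ball (extChartAt 𝓘(ℝ, E') w w) (r w)) :=
    ⟨Metric.mem_ball_self (hr w), hwt.2⟩
  rw [← cylChart_extChartAt (E' := E') w t]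
  generalize (extChartAt 𝓘(ℝ, E') w w, t) = p at hp
  intro u
  obtain ⟨u, rfl⟩ := mfderiv_cylChart_surjective w (hrt w hp.1) u
  have h2 : (mfderiv 𝓘(ℝ, E' × ℝ) (𝓘(ℝ, E').prod 𝓘(ℝ, ℝ)) (cylChart w) p u).2 = u.2 := by
    rw [mfderiv_cylChart w (hrt w hp.1)]
  refine (fderivWithin_comp_cylChart w Metric.isOpen_ball (hrt w) hp hGc u).symm.trans ?_
  rw [h2, (key w p hp).fderivWithin (uniqueDiffOn_box Metric.isOpen_ball p hp)]
  exact congrArg (· + _) (localForm_apply (θ := θ) hF w Metric.isOpen_ball (hrt w) hp u)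

end Primitives

end FigureEight

namespace FigureEight

/-! ### Calculus on the circle in the parameter `Θ`, and cutoff functions -/

section CircleCalculus

attribute [local instance] finrank_real_complex_fact'

lemma contMDiff_circle_re : ContMDiff (𝓡 1) 𝓘(ℝ, ℝ) ∞ fun z : Circle => (z : ℂ).re :=
  Complex.reCLM.contDiff.contMDiff.comp (contMDiff_coe_sphere (E := ℂ) (n := 1))

lemma contMDiff_circle_im : ContMDiff (𝓡 1) 𝓘(ℝ, ℝ) ∞ fun z : Circle => (z : ℂ).im :=
  Complex.imCLM.contDiff.contMDiff.comp (contMDiff_coe_sphere (E := ℂ) (n := 1))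

lemma contMDiff_pt : ContMDiff 𝓘(ℝ, ℝ) (𝓡 1) ∞ pt :=
  contMDiff_circleExp.comp (contDiff_const.mul contDiff_id).contMDiff

lemma pt_re (s : ℝ) : (pt s : ℂ).re = Real.cos (Real.pi * s) := by
  rw [pt, Circle.coe_exp, Complex.exp_ofReal_mul_I_re]

lemma pt_im (s : ℝ) : (pt s : ℂ).im = Real.sin (Real.pi * s) := by
  rw [pt, Circle.coe_exp, Complex.exp_ofReal_mul_I_im]

lemma pt_zero : pt 0 = 1 := by simp [pt]

lemma pt_add (s t : ℝ) : pt (s + t) = pt s * pt t := by rw [pt, mul_add, Circle.exp_add]; rfl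

lemma pt_add_two (s : ℝ) : pt (s + 2) = pt s := by
  rw [pt, mul_add, mul_comm Real.pi 2, Circle.exp_add_two_pi]; rfl

lemma circle_ext {z z' : Circle} (h1 : (z : ℂ).re = (z' : ℂ).re) (h2 : (z : ℂ).im = (z' : ℂ).im) :
    z = z' := Circle.ext (Complex.ext h1 h2)

lemma circle_sq_add_sq (z : Circle) : (z : ℂ).re ^ 2 + (z : ℂ).im ^ 2 = 1 := by
  have := Circle.normSq_coe z
  rw [Complex.normSq_apply] at this
  linarith

/-- The circle is covered by the two arcs and the set where `|Im z| ≥ sin (π δ)`. -/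
lemma mem_arc_of_im_lt {δ : ℝ} (h₀ : 0 < δ) (z : Circle)
    (hz : |(z : ℂ).im| < Real.sin (Real.pi * δ)) : z ∈ arc 0 δ ∨ z ∈ arc 1 δ := by
  obtain ⟨s, hs, rfl⟩ : ∃ s ∈ Set.Ioc (-1 : ℝ) 1, pt s = z := by
    refine ⟨Complex.arg z / Real.pi, ⟨?_, ?_⟩, ?_⟩
    · rw [lt_div_iff₀ Real.pi_pos]
      linarith [Complex.neg_pi_lt_arg (z : ℂ)]
    · rw [div_le_iff₀ Real.pi_pos]
      linarith [Complex.arg_le_pi (z : ℂ)]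
    · rw [pt, mul_div_cancel₀ _ Real.pi_ne_zero, Circle.exp_arg]
  by_contra! hcon
  have h1 : δ ≤ |s| := by
    by_contra! h
    exact hcon.1 ⟨s, by simpa using h, rfl⟩
  have h2 : |s| ≤ 1 - δ := by
    by_contra! h
    rcases le_or_gt 0 s with h3 | h3
    · rw [abs_of_nonneg h3] at h
      exact hcon.2 ⟨s, show |s - 1| < δ from abs_lt.2 ⟨by linarith, by linarith [hs.2]⟩, rfl⟩
    · rw [abs_of_neg h3] at h
      exact hcon.2 ⟨s + 2, show |s + 2 - 1| < δ from
        abs_lt.2 ⟨by linarith [hs.1], by linarith⟩, pt_add_two s⟩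
  have hpi := Real.pi_pos
  -- Now `δ ≤ |s| ≤ 1 - δ`, and the sine is symmetric about `π / 2` and increasing before it.
  have h3 : Real.sin (Real.pi * δ) ≤ Real.sin (Real.pi * |s|) := by
    rcases le_or_gt |s| (1 / 2) with h | h
    · exact Real.sin_le_sin_of_le_of_le_pi_div_two (by nlinarith) (by nlinarith) (by nlinarith)
    · rw [← Real.sin_pi_sub (Real.pi * |s|)]
      exact Real.sin_le_sin_of_le_of_le_pi_div_two (by nlinarith) (by nlinarith) (by nlinarith)
  rw [pt_im] at hz
  rcases abs_cases s with ⟨h4, _⟩ | ⟨h4, _⟩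
  · rw [h4] at h3
    linarith [le_abs_self (Real.sin (Real.pi * s))]
  · rw [h4, mul_neg, Real.sin_neg] at h3
    linarith [neg_le_abs (Real.sin (Real.pi * s))]

lemma hasDerivAt_re_rotate (z : Circle) :
    HasDerivAt (fun s : ℝ => ((z * pt s : Circle) : ℂ).re) (-(Real.pi * (z : ℂ).im)) 0 := by
  have h0 : HasDerivAt (fun s : ℝ => Real.pi * s) Real.pi 0 := by
    simpa using (hasDerivAt_id (0 : ℝ)).const_mul Real.pi
  have h := (h0.cos.const_mul (z : ℂ).re).sub (h0.sin.const_mul (z : ℂ).im)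
  simp only [Circle.coe_mul, Complex.mul_re, pt_re, pt_im]
  exact h.congr_deriv (by simp [mul_comm])

lemma hasDerivAt_im_rotate (z : Circle) :
    HasDerivAt (fun s : ℝ => ((z * pt s : Circle) : ℂ).im) (Real.pi * (z : ℂ).re) 0 := by
  have h0 : HasDerivAt (fun s : ℝ => Real.pi * s) Real.pi 0 := by
    simpa using (hasDerivAt_id (0 : ℝ)).const_mul Real.pi
  have h := (h0.sin.const_mul (z : ℂ).re).add (h0.cos.const_mul (z : ℂ).im)
  simp only [Circle.coe_mul, Complex.mul_im, pt_re, pt_im]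
  exact h.congr_deriv (by simp [mul_comm])

lemma contMDiff_rotate (z : Circle) : ContMDiff 𝓘(ℝ, ℝ) (𝓡 1) ∞ fun s : ℝ => z * pt s :=
  have : LieGroup (𝓡 1) ∞ Circle := LieGroup.of_le (n := ω) le_top
  contMDiff_const.mul contMDiff_pt

/-- The unit tangent field of the circle, with respect to the parameter. -/
noncomputable def tangentUnit (z : Circle) : TangentSpace (𝓡 1) z :=
  mfderiv 𝓘(ℝ, ℝ) (𝓡 1) (fun s : ℝ => z * pt s) 0 (1 : ℝ)

variable {X : Type*} [NormedAddCommGroup X] [NormedSpace ℝ X]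

lemma rotate_zero (z : Circle) : z * pt 0 = z := by rw [pt_zero, mul_one]

lemma mfderiv_tangentUnit {g : Circle → X} {z : Circle} (hg : MDifferentiableAt (𝓡 1) 𝓘(ℝ, X) g z) :
    mfderiv (𝓡 1) 𝓘(ℝ, X) g z (tangentUnit z) = dTheta g z := by
  have h1 : MDifferentiableAt 𝓘(ℝ, ℝ) (𝓡 1) (fun s : ℝ => z * pt s) 0 :=
    (contMDiff_rotate z).mdifferentiableAt (by simp)
  have h2 := mfderiv_comp_of_eq (x := (0 : ℝ)) hg h1 (rotate_zero z)
  rw [dTheta, ← fderiv_apply_one_eq_deriv, ← mfderiv_eq_fderiv]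
  let L : Circle → EuclideanSpace ℝ (Fin 1) →L[ℝ] X := fun w => mfderiv (𝓡 1) 𝓘(ℝ, X) g w
  have h3 : L (z * pt 0) (tangentUnit z) = L z (tangentUnit z) := by rw [rotate_zero]
  exact h3.symm.trans (DFunLike.congr_fun h2 (1 : ℝ)).symm

lemma dTheta_re (z : Circle) : dTheta (fun z : Circle => (z : ℂ).re) z = -(Real.pi * (z : ℂ).im) :=
  (hasDerivAt_re_rotate z).deriv

lemma dTheta_im (z : Circle) : dTheta (fun z : Circle => (z : ℂ).im) z = Real.pi * (z : ℂ).re :=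
  (hasDerivAt_im_rotate z).deriv

/-- Otherwise the `Θ`-derivatives `-π y` and `π x` of the coordinates would both vanish, against `x²
+ y² = 1`. -/
lemma tangentUnit_ne_zero (z : Circle) : tangentUnit z ≠ 0 := by
  intro h
  have h1 := mfderiv_tangentUnit (contMDiff_circle_re.mdifferentiableAt (x := z) (by simp))
  have h2 := mfderiv_tangentUnit (contMDiff_circle_im.mdifferentiableAt (x := z) (by simp))
  rw [h, dTheta_re] at h1
  rw [h, dTheta_im] at h2
  have h3 : (z : ℂ).im = 0 := by
    have : (0 : ℝ) = -(Real.pi * (z : ℂ).im) := (map_zero _).symm.trans h1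
    have h4 : Real.pi * (z : ℂ).im = 0 := by linarith
    exact (mul_eq_zero.1 h4).resolve_left Real.pi_ne_zero
  have h4 : (z : ℂ).re = 0 := by
    have : (0 : ℝ) = Real.pi * (z : ℂ).re := (map_zero _).symm.trans h2
    exact (mul_eq_zero.1 this.symm).resolve_left Real.pi_ne_zero
  have := circle_sq_add_sq z
  rw [h3, h4] at this
  norm_num at this

lemma exists_smul_tangentUnit (z : Circle) (v : TangentSpace (𝓡 1) z) :
    ∃ c : ℝ, v = c • tangentUnit z := by
  have h : Module.finrank ℝ (TangentSpace (𝓡 1) z) = 1 := by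
    change Module.finrank ℝ (EuclideanSpace ℝ (Fin 1)) = 1
    simp
  obtain ⟨c, hc⟩ := (finrank_eq_one_iff_of_nonzero' (tangentUnit z) (tangentUnit_ne_zero z)).1 h v
  exact ⟨c, hc.symm⟩

lemma contMDiff_dTheta {g : Circle → ℝ} (hg : ContMDiff (𝓡 1) 𝓘(ℝ, ℝ) ∞ g) :
    ContMDiff (𝓡 1) 𝓘(ℝ, ℝ) ∞ (dTheta g) := by
  have : LieGroup (𝓡 1) ∞ Circle := LieGroup.of_le (n := ω) le_top
  intro z
  have h1 : ContMDiffAt ((𝓡 1).prod 𝓘(ℝ, ℝ)) 𝓘(ℝ, ℝ) ∞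
      (Function.uncurry fun (z : Circle) (s : ℝ) => g (z * pt s)) (z, (0 : ℝ)) :=
    (hg.comp (contMDiff_fst.mul (contMDiff_pt.comp contMDiff_snd))).contMDiffAt
  have h2 := h1.mfderiv (fun (z : Circle) (s : ℝ) => g (z * pt s)) (fun _ => (0 : ℝ))
    contMDiffAt_const (m := ∞) (by simp)
  -- Source and target of the differentiated map are the line, so the tangent coordinates are
  -- trivial.
  have he := inTangentCoordinates_model_space (I := 𝓘(ℝ, ℝ)) (I' := 𝓘(ℝ, ℝ)) (fun _ : Circle => (0 : ℝ))
    (fun w : Circle => g (w * pt 0))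
    (fun w : Circle => (mfderiv 𝓘(ℝ, ℝ) 𝓘(ℝ, ℝ) (fun s : ℝ => g (w * pt s)) 0 : ℝ →L[ℝ] ℝ)) z
  have h2 := h2.congr_of_eventuallyEq (f₁ :=
    fun w => (mfderiv 𝓘(ℝ, ℝ) 𝓘(ℝ, ℝ) (fun s : ℝ => g (w * pt s)) 0 : ℝ →L[ℝ] ℝ))
    (Filter.Eventually.of_forall fun w => (congrFun he w).symm)
  have h3 := h2.clm_apply (contMDiffAt_const (c := (1 : ℝ)))
  refine h3.congr_of_eventuallyEq (Filter.Eventually.of_forall fun w => ?_)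
  rw [dTheta, ← fderiv_apply_one_eq_deriv, ← mfderiv_eq_fderiv]

lemma hasDerivAt_dTheta {g : Circle → X} {z : Circle} (hg : MDifferentiableAt (𝓡 1) 𝓘(ℝ, X) g z) :
    HasDerivAt (fun s : ℝ => g (z * pt s)) (dTheta g z) 0 := by
  have h1 : MDifferentiableAt 𝓘(ℝ, ℝ) (𝓡 1) (fun s : ℝ => z * pt s) 0 :=
    (contMDiff_rotate z).mdifferentiableAt (by simp)
  have h2 : MDifferentiableAt 𝓘(ℝ, ℝ) 𝓘(ℝ, X) (fun s : ℝ => g (z * pt s)) 0 :=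
    MDifferentiableAt.comp_of_eq (x := (0 : ℝ)) hg h1 (rotate_zero z)
  exact (mdifferentiableAt_iff_differentiableAt.1 h2).hasDerivAt

/-- There are smooth cutoff functions on the circle. -/
lemma exists_isCutoff {δ : ℝ} (h₁ : δ < 1 / 2) : ∃ ρ : Circle → ℝ, IsCutoff δ ρ := by
  rcases le_or_gt δ 0 with h₀ | h₀
  · have he : ∀ c, arc c δ = ∅ := fun c => by
      have : {s : ℝ | |s - c| < δ} = ∅ :=
        Set.eq_empty_of_forall_notMem fun s hs => (abs_nonneg _).not_gt (lt_of_lt_of_le hs h₀)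
      rw [arc, this, Set.image_empty]
    exact ⟨fun _ => 0, contMDiff_const, fun _ => ⟨le_rfl, zero_le_one⟩, fun _ _ => rfl,
      fun z hz => by simp [he] at hz⟩
  set κ := Real.cos (Real.pi * δ) with hκ
  have hpi := Real.pi_pos
  have hκ0 : 0 < κ := Real.cos_pos_of_mem_Ioo ⟨by nlinarith, by nlinarith⟩
  have hcos : ∀ s : ℝ, |s| < δ → κ ≤ Real.cos (Real.pi * s) := by
    intro s hs
    rw [← Real.cos_abs (Real.pi * s), abs_mul, abs_of_pos hpi]
    exact Real.cos_le_cos_of_nonneg_of_le_pi (by positivity) (by nlinarith) (by nlinarith)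
  -- The real part is at least `κ` on the arc about `0` and at most `-κ` on the arc about `±1`; the
  -- affine rescaling sends these values to `0` and `1`. Here `κ > 0` because `δ < 1 / 2`.
  refine ⟨fun z => Real.smoothTransition ((κ - (z : ℂ).re) / (2 * κ)), ?_, ?_, ?_, ?_⟩
  · refine Real.smoothTransition.contDiff.contMDiff.comp ?_
    exact (show ContDiff ℝ ∞ fun x : ℝ => (κ - x) / (2 * κ) by fun_prop).contMDiff.comp
      contMDiff_circle_re
  · exact fun z => ⟨Real.smoothTransition.nonneg _, Real.smoothTransition.le_one _⟩
  · rintro _ ⟨s, hs, rfl⟩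
    have := hcos s (by simpa using hs)
    refine Real.smoothTransition.zero_of_nonpos ?_
    rw [pt_re]
    exact div_nonpos_of_nonpos_of_nonneg (by linarith) (by positivity)
  · rintro _ ⟨s, hs, rfl⟩
    have h1 := hcos (s - 1) hs
    have h2 : Real.cos (Real.pi * (s - 1)) = -Real.cos (Real.pi * s) := by
      rw [mul_sub, mul_one, Real.cos_sub_pi]
    refine Real.smoothTransition.one_of_one_le ?_
    rw [pt_re, le_div_iff₀ (by positivity)]
    linarith

/-- Forces `Φ = 0` over both arcs, where the annulus map need not be injective. -/
lemma dTheta_eq_zero_of_eqOn_arc {ρ : Circle → ℝ} {c δ k : ℝ} (h : ∀ z ∈ arc c δ, ρ z = k)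
    {z : Circle} (hz : z ∈ arc c δ) : dTheta ρ z = 0 := by
  obtain ⟨s₀, hs₀, rfl⟩ := hz
  have h1 : (fun s : ℝ => ρ (pt s₀ * pt s)) =ᶠ[𝓝 0] fun _ => k := by
    have h2 : ∀ᶠ s : ℝ in 𝓝 0, |s₀ + s - c| < δ :=
      (show ContinuousAt (fun s : ℝ => |s₀ + s - c|) 0 by fun_prop).eventually_lt
        continuousAt_const (by simpa using hs₀)
    filter_upwards [h2] with s hs
    exact h _ ⟨s₀ + s, hs, pt_add _ _⟩
  rw [dTheta, h1.deriv_eq]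
  simp

end CircleCalculus

end FigureEight

namespace FigureEight

/-! ### A globally smooth version of the small root of a quadratic -/

section RootFunction

/-- A smooth function `h` on the line with `h t - t (h t)² = 1` near `0`. -/
lemma exists_smooth_root : ∃ h : ℝ → ℝ, ContDiff ℝ ∞ h ∧ (∀ t, 0 ≤ h t ∧ h t ≤ 2) ∧
    ∀ t, |t| ≤ 1 / 16 → h t - t * h t ^ 2 = 1 := by
  -- The root regular at `0` is `2 / (1 + √(1 - 4 t))`. Replacing `t` by `t * b t` keeps the
  -- radicand at least `1 / 2` everywhere and changes nothing for `|t| ≤ 1 / 16`.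
  let b : ContDiffBump (0 : ℝ) := ⟨1 / 16, 1 / 8, by norm_num, by norm_num⟩
  have hb : ∀ t : ℝ, t * b t ≤ 1 / 8 := by
    intro t
    by_cases ht : |t| < 1 / 8
    · have h1 := abs_lt.1 ht
      nlinarith [b.nonneg (x := t), b.le_one (x := t)]
    · have : b t = 0 := b.zero_of_le_dist (by simpa [Real.dist_eq, b] using not_lt.1 ht)
      rw [this]
      norm_num
  have hq : ∀ t : ℝ, (1 / 2 : ℝ) ≤ 1 - 4 * (t * b t) := fun t => by linarith [hb t]
  have hs : ∀ t : ℝ, 0 ≤ Real.sqrt (1 - 4 * (t * b t)) := fun t => Real.sqrt_nonneg _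
  refine ⟨fun t => 2 / (1 + Real.sqrt (1 - 4 * (t * b t))), ?_, fun t => ⟨?_, ?_⟩, fun t ht => ?_⟩
  · refine contDiff_const.div (contDiff_const.add (ContDiff.sqrt ?_ fun t => ?_)) fun t => ?_
    · exact contDiff_const.sub (contDiff_const.mul (contDiff_id.mul b.contDiff))
    · linarith [hq t]
    · linarith [hs t]
  · exact div_nonneg zero_le_two (by linarith [hs t])
  · rw [div_le_iff₀ (by linarith [hs t])]
    linarith [hs t]
  · have hbt : b t = 1 := b.one_of_mem_closedBall (by simpa [Real.dist_eq, b] using ht)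
    simp only [hbt, mul_one]
    have h1 := abs_le.1 ht
    have h2 : Real.sqrt (1 - 4 * t) ^ 2 = 1 - 4 * t := Real.sq_sqrt (by linarith)
    have h3 : 0 ≤ Real.sqrt (1 - 4 * t) := Real.sqrt_nonneg _
    generalize Real.sqrt (1 - 4 * t) = q at h2 h3
    have h4 : 1 + q ≠ 0 := by linarith
    field_simp
    nlinarith

end RootFunction

/-! ### Injectivity of the annulus map as an algebraic statement -/

section Injectivity

/-- For `y > 0` the square of `2 x (y - 2 r)` is determined by `r` once `y - r` is given. -/
lemma root_not_lt {x y r x' y' r' : ℝ} (h : x ^ 2 + y ^ 2 = 1) (h' : x' ^ 2 + y' ^ 2 = 1)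
    (hX : y - r = y' - r') (hY : x * (y - 2 * r) = x' * (y' - 2 * r')) (hy : 0 < y)
    (hr' : 2 * r' < y') : ¬ r < r' := by
  intro hlt
  have hyy : y < y' := by linarith
  have h1 : x' ^ 2 < x ^ 2 := by nlinarith
  have h2 : 0 < y' - 2 * r' := by linarith
  have h3 : y' - 2 * r' < y - 2 * r := by linarith
  have h4 : (x * (y - 2 * r)) ^ 2 = (x' * (y' - 2 * r')) ^ 2 := by rw [hY]
  have h5 : (y' - 2 * r') ^ 2 < (y - 2 * r) ^ 2 := by nlinarith
  have h6 : x' ^ 2 * (y' - 2 * r') ^ 2 < x ^ 2 * (y - 2 * r) ^ 2 :=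
    mul_lt_mul'' h1 h5 (sq_nonneg _) (sq_nonneg _)
  rw [mul_pow, mul_pow] at h4
  linarith

lemma root_eq_of_pos {x y r x' y' r' : ℝ} (h : x ^ 2 + y ^ 2 = 1) (h' : x' ^ 2 + y' ^ 2 = 1)
    (hX : y - r = y' - r') (hY : x * (y - 2 * r) = x' * (y' - 2 * r')) (hy : 0 < y) (hy' : 0 < y')
    (hr : 2 * r < y) (hr' : 2 * r' < y') : x = x' ∧ y = y' ∧ r = r' := by
  have h1 := root_not_lt h h' hX hY hy hr'
  have h2 := root_not_lt h' h hX.symm hY.symm hy' hr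
  have h3 : r = r' := le_antisymm (not_lt.1 h2) (not_lt.1 h1)
  subst h3
  have h4 : y = y' := by linarith
  subst h4
  exact ⟨mul_right_cancel₀ (by linarith) hY, rfl, rfl⟩

/-- When `|r| < |y| / 2`, or `r = 0`, the first coordinate `y - r` has the sign of `y`, so points of
different signs are separated. Equal signs reduce to `y, y' > 0` by negating `y` and `r`, where
`root_not_lt` forces `r = r'`. -/
lemma root_injective {x y r x' y' r' : ℝ} (h : x ^ 2 + y ^ 2 = 1) (h' : x' ^ 2 + y' ^ 2 = 1)
    (hX : y - r = y' - r') (hY : x * (y - 2 * r) = x' * (y' - 2 * r'))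
    (hr : r = 0 ∨ |r| < |y| / 2) (hr' : r' = 0 ∨ |r'| < |y'| / 2) :
    (x = x' ∧ y = y' ∧ r = r') ∨ (y = 0 ∧ r = 0 ∧ y' = 0 ∧ r' = 0) := by
  have key : ∀ y r : ℝ, (r = 0 ∨ |r| < |y| / 2) → (y = 0 ∧ r = 0) ∨
      (0 < y ∧ 2 * r < y ∧ 0 < y - r) ∨ (y < 0 ∧ y < 2 * r ∧ y - r < 0) := by
    intro y r hr
    rcases lt_trichotomy y 0 with hy | rfl | hy
    · right; right
      rcases hr with rfl | hr
      · exact ⟨hy, by linarith, by linarith⟩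
      · rw [abs_of_neg hy] at hr
        have := abs_lt.1 hr
        exact ⟨hy, by linarith, by linarith⟩
    · left
      rcases hr with rfl | hr
      · exact ⟨rfl, rfl⟩
      · rw [abs_zero, zero_div] at hr
        exact absurd hr (abs_nonneg r).not_gt
    · right; left
      rcases hr with rfl | hr
      · exact ⟨hy, by linarith, by linarith⟩
      · rw [abs_of_pos hy] at hr
        have := abs_lt.1 hr
        exact ⟨hy, by linarith, by linarith⟩
  rcases key y r hr with ⟨h1, h2⟩ | ⟨h1, h2, h3⟩ | ⟨h1, h2, h3⟩ <;>
    rcases key y' r' hr' with ⟨h4, h5⟩ | ⟨h4, h5, h6⟩ | ⟨h4, h5, h6⟩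
  · exact Or.inr ⟨h1, h2, h4, h5⟩
  · linarith
  · linarith
  · linarith
  · exact Or.inl (root_eq_of_pos h h' hX hY h1 h4 h2 h5)
  · linarith
  · linarith
  · linarith
  · obtain ⟨e1, e2, e3⟩ := root_eq_of_pos (x := x) (y := -y) (r := -r) (x' := x') (y' := -y')
      (r' := -r') (by linarith) (by linarith) (by linarith) (by linarith) (by linarith)
      (by linarith) (by linarith) (by linarith)
    exact Or.inl ⟨e1, by linarith, by linarith⟩

end Injectivity

/-! ### The explicit figure eight map and its area form -/

section TheMap

/-- The figure eight map and the primitive of `a^* (x dy) - s dΘ`, in terms of a function `r` on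
`S¹ × ℝ` which solves `2 π l² (r - y r²) = s`. -/
noncomputable def eightMap (l : ℝ) (r : Circle × ℝ → ℝ) (p : Circle × ℝ) : ℝ × ℝ :=
  (l * ((p.1 : ℂ).im - r p), l * (2 * (p.1 : ℂ).re * ((p.1 : ℂ).im - 2 * r p)))

noncomputable def eightPrimitive (l : ℝ) (r : Circle × ℝ → ℝ) (p : Circle × ℝ) : ℝ :=
  l ^ 2 * (2 * (p.1 : ℂ).re - 4 / 3 * (p.1 : ℂ).re ^ 3 -
    4 * (p.1 : ℂ).re * (p.1 : ℂ).im * r p + 2 * (p.1 : ℂ).re * r p ^ 2)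

/-- With `c = 2 π l²` the equation is `r - y r² = s / c`, solved by `r = σ h(y σ)` for `σ = s / c`.
Enlarging the figure eight makes `σ`, hence `r`, as small as desired. -/
lemma exists_root_map (η L : ℝ) (hη : 0 < η) (hη1 : η ≤ 1) (hL : 0 ≤ L) :
    ∃ (l : ℝ) (r : Circle × ℝ → ℝ), 0 < l ∧
      ContMDiff ((𝓡 1).prod 𝓘(ℝ, ℝ)) 𝓘(ℝ, ℝ) ∞ r ∧
      (∀ z, r (z, 0) = 0) ∧ (∀ z s, |s| ≤ L → |r (z, s)| < η / 2) ∧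
      (∀ z s, |s| < L + 1 → 2 * Real.pi * l ^ 2 * (r (z, s) - (z : ℂ).im * r (z, s) ^ 2) = s) := by
  obtain ⟨h, hs, hb, hr⟩ := exists_smooth_root
  have hpi := Real.pi_pos
  -- Gives `|s / c| < η / 16` for `|s| < L + 1`: with `η ≤ 1` the argument of `h` stays in `[-1/16,
  -- 1/16]`, and `h ≤ 2` bounds `|r|` by less than `η / 2`. The margin beyond `L` allows
  -- differentiating the equation at `|s| = L`.
  set c := 16 * (L + 1) / η with hc
  have hc0 : 0 < c := by positivity
  set l := Real.sqrt (c / (2 * Real.pi)) with hl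
  have hl0 : 0 < l := Real.sqrt_pos.2 (by positivity)
  have hl2 : 2 * Real.pi * l ^ 2 = c := by
    rw [hl, Real.sq_sqrt (by positivity)]
    field_simp
  have hσ : ∀ s : ℝ, |s| < L + 1 → |s / c| < η / 16 := by
    intro s hs
    rw [abs_div, abs_of_pos hc0, div_lt_iff₀ hc0, hc]
    field_simp
    linarith
  have him : ∀ z : Circle, |(z : ℂ).im| ≤ 1 := fun z =>
    (Complex.abs_im_le_norm _).trans_eq (Circle.norm_coe z)
  refine ⟨l, fun p => p.2 / c * h ((p.1 : ℂ).im * (p.2 / c)), hl0, ?_, fun z => by simp, ?_, ?_⟩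
  · have h1 : ContMDiff ((𝓡 1).prod 𝓘(ℝ, ℝ)) 𝓘(ℝ, ℝ) ∞ fun p : Circle × ℝ => p.2 / c :=
      (show ContDiff ℝ ∞ fun x : ℝ => x / c by fun_prop).contMDiff.comp contMDiff_snd
    exact h1.mul (hs.contMDiff.comp ((contMDiff_circle_im.comp contMDiff_fst).mul h1))
  · intro z s hs
    have h1 := hσ s (by linarith)
    obtain ⟨h2, h3⟩ := hb ((z : ℂ).im * (s / c))
    simp only
    rw [abs_mul, abs_of_nonneg h2]
    nlinarith [abs_nonneg (s / c)]
  · intro z s hs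
    have h1 := hσ s hs
    have h2 : |(z : ℂ).im * (s / c)| ≤ 1 / 16 := by
      rw [abs_mul]
      nlinarith [abs_nonneg (s / c), him z, abs_nonneg (z : ℂ).im]
    have h3 := hr _ h2
    rw [hl2]
    simp only
    generalize h ((z : ℂ).im * (s / c)) = k at h3
    have h4 : s / c * k - (z : ℂ).im * (s / c * k) ^ 2 = s / c := by
      linear_combination (s / c) * h3
    rw [h4]
    field_simp

variable {l : ℝ} {r : Circle × ℝ → ℝ}

lemma contMDiff_eightMap (hr : ContMDiff ((𝓡 1).prod 𝓘(ℝ, ℝ)) 𝓘(ℝ, ℝ) ∞ r) :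
    ContMDiff ((𝓡 1).prod 𝓘(ℝ, ℝ)) 𝓘(ℝ, ℝ × ℝ) ∞ (eightMap l r) := by
  have hx := contMDiff_circle_re.comp (contMDiff_fst (I := 𝓡 1) (J := 𝓘(ℝ, ℝ)) (M := Circle) (N := ℝ))
  have hy := contMDiff_circle_im.comp (contMDiff_fst (I := 𝓡 1) (J := 𝓘(ℝ, ℝ)) (M := Circle) (N := ℝ))
  exact (show ContDiff ℝ ∞ fun q : ℝ × ℝ × ℝ =>
    (l * (q.2.1 - q.2.2), l * (2 * q.1 * (q.2.1 - 2 * q.2.2))) by fun_prop).contMDiff.comp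
      (hx.prodMk_space (hy.prodMk_space hr))

lemma contMDiff_eightPrimitive (hr : ContMDiff ((𝓡 1).prod 𝓘(ℝ, ℝ)) 𝓘(ℝ, ℝ) ∞ r) :
    ContMDiff ((𝓡 1).prod 𝓘(ℝ, ℝ)) 𝓘(ℝ, ℝ) ∞ (eightPrimitive l r) := by
  have hx := contMDiff_circle_re.comp (contMDiff_fst (I := 𝓡 1) (J := 𝓘(ℝ, ℝ)) (M := Circle) (N := ℝ))
  have hy := contMDiff_circle_im.comp (contMDiff_fst (I := 𝓡 1) (J := 𝓘(ℝ, ℝ)) (M := Circle) (N := ℝ))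
  exact (show ContDiff ℝ ∞ fun q : ℝ × ℝ × ℝ => l ^ 2 * (2 * q.1 - 4 / 3 * q.1 ^ 3 -
    4 * q.1 * q.2.1 * q.2.2 + 2 * q.1 * q.2.2 ^ 2) by fun_prop).contMDiff.comp
      (hx.prodMk_space (hy.prodMk_space hr))

lemma hasDerivAt_root_right (hr : ContMDiff ((𝓡 1).prod 𝓘(ℝ, ℝ)) 𝓘(ℝ, ℝ) ∞ r) (z : Circle)
    (s : ℝ) : HasDerivAt (fun s => r (z, s)) (deriv (fun s => r (z, s)) s) s := by
  have h : ContMDiff 𝓘(ℝ, ℝ) 𝓘(ℝ, ℝ) ∞ fun s => r (z, s) :=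
    hr.comp (contMDiff_const.prodMk contMDiff_id)
  exact (h.contDiff.differentiable (by simp) s).hasDerivAt

lemma hasDerivAt_root_left (hr : ContMDiff ((𝓡 1).prod 𝓘(ℝ, ℝ)) 𝓘(ℝ, ℝ) ∞ r) (z : Circle)
    (s : ℝ) : HasDerivAt (fun t => r (z * pt t, s)) (dTheta (fun z => r (z, s)) z) 0 := by
  have h : ContMDiff (𝓡 1) 𝓘(ℝ, ℝ) ∞ fun z => r (z, s) :=
    hr.comp (contMDiff_id.prodMk contMDiff_const)
  exact hasDerivAt_dTheta (h.mdifferentiableAt (by simp))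

lemma hasDerivAt_eightMap_right (hr : ContMDiff ((𝓡 1).prod 𝓘(ℝ, ℝ)) 𝓘(ℝ, ℝ) ∞ r) (z : Circle)
    (s : ℝ) : HasDerivAt (fun s => eightMap l r (z, s))
      (-(l * deriv (fun s => r (z, s)) s),
        -(4 * l * (z : ℂ).re * deriv (fun s => r (z, s)) s)) s := by
  have h := hasDerivAt_root_right hr z s
  refine HasDerivAt.prodMk ?_ ?_
  · refine ((h.const_sub (z : ℂ).im).const_mul l).congr_deriv ?_
    ring
  · refine ((((h.const_mul 2).const_sub (z : ℂ).im).const_mul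
      (2 * (z : ℂ).re)).const_mul l).congr_deriv ?_
    ring

lemma hasDerivAt_eightMap_left (hr : ContMDiff ((𝓡 1).prod 𝓘(ℝ, ℝ)) 𝓘(ℝ, ℝ) ∞ r) (z : Circle)
    (s : ℝ) : HasDerivAt (fun t => eightMap l r (z * pt t, s))
      (l * (Real.pi * (z : ℂ).re - dTheta (fun z => r (z, s)) z),
        2 * l * (-(Real.pi * (z : ℂ).im) * ((z : ℂ).im - 2 * r (z, s)) +
          (z : ℂ).re * (Real.pi * (z : ℂ).re - 2 * dTheta (fun z => r (z, s)) z))) 0 := by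
  have h := hasDerivAt_root_left hr z s
  have hx := hasDerivAt_re_rotate z
  have hy := hasDerivAt_im_rotate z
  refine HasDerivAt.prodMk ?_ ?_
  · exact (hy.sub h).const_mul l
  · refine (((hx.const_mul 2).mul (hy.sub (h.const_mul 2))).const_mul l).congr_deriv ?_
    simp only [Pi.sub_apply, rotate_zero]
    ring

lemma hasDerivAt_eightPrimitive_right (hr : ContMDiff ((𝓡 1).prod 𝓘(ℝ, ℝ)) 𝓘(ℝ, ℝ) ∞ r)
    (z : Circle) (s : ℝ) : HasDerivAt (fun s => eightPrimitive l r (z, s))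
      (4 * l ^ 2 * (z : ℂ).re * (r (z, s) - (z : ℂ).im) * deriv (fun s => r (z, s)) s) s := by
  have h := hasDerivAt_root_right hr z s
  refine ((((h.const_mul (4 * (z : ℂ).re * (z : ℂ).im)).const_sub
    (2 * (z : ℂ).re - 4 / 3 * (z : ℂ).re ^ 3)).add
      ((h.pow 2).const_mul (2 * (z : ℂ).re))).const_mul (l ^ 2)).congr_deriv ?_
  push_cast
  ring

lemma hasDerivAt_eightPrimitive_left (hr : ContMDiff ((𝓡 1).prod 𝓘(ℝ, ℝ)) 𝓘(ℝ, ℝ) ∞ r)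
    (z : Circle) (s : ℝ) : HasDerivAt (fun t => eightPrimitive l r (z * pt t, s))
      (l ^ 2 * (-(2 * Real.pi * (z : ℂ).im) + 4 * Real.pi * (z : ℂ).re ^ 2 * (z : ℂ).im +
        4 * Real.pi * ((z : ℂ).im ^ 2 - (z : ℂ).re ^ 2) * r (z, s) -
        4 * (z : ℂ).re * (z : ℂ).im * dTheta (fun z => r (z, s)) z -
        2 * Real.pi * (z : ℂ).im * r (z, s) ^ 2 +
        4 * (z : ℂ).re * r (z, s) * dTheta (fun z => r (z, s)) z)) 0 := by
  have h := hasDerivAt_root_left hr z s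
  have hx := hasDerivAt_re_rotate z
  have hy := hasDerivAt_im_rotate z
  refine (((((hx.const_mul 2).sub ((hx.pow 3).const_mul (4 / 3))).sub
    (((hx.const_mul 4).mul hy).mul h)).add ((hx.const_mul 2).mul (h.pow 2))).const_mul
      (l ^ 2)).congr_deriv ?_
  simp only [Pi.mul_apply, Pi.pow_apply, rotate_zero]
  push_cast
  ring

/-- The derivative of the root in the fibre direction. -/
lemma deriv_root {L : ℝ} (hr : ContMDiff ((𝓡 1).prod 𝓘(ℝ, ℝ)) 𝓘(ℝ, ℝ) ∞ r)
    (heq : ∀ z s, |s| < L + 1 →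
      2 * Real.pi * l ^ 2 * (r (z, s) - (z : ℂ).im * r (z, s) ^ 2) = s)
    (z : Circle) {s : ℝ} (hs : |s| ≤ L) :
    2 * Real.pi * l ^ 2 * (1 - 2 * (z : ℂ).im * r (z, s)) * deriv (fun s => r (z, s)) s = 1 := by
  have h := hasDerivAt_root_right hr z s
  have h1 := (h.sub ((h.pow 2).const_mul (z : ℂ).im)).const_mul (2 * Real.pi * l ^ 2)
  have h2 : ∀ᶠ t in 𝓝 s, |t| < L + 1 :=
    continuous_abs.continuousAt.eventually_lt continuousAt_const (by linarith)
  have h3 := (hasDerivAt_id s).congr_of_eventuallyEq (f₁ := fun t =>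
    2 * Real.pi * l ^ 2 * (r (z, t) - (z : ℂ).im * r (z, t) ^ 2)) (h2.mono fun t ht => heq z t ht)
  have h4 := h1.unique h3
  push_cast at h4
  linarith

/-- The terms in `∂_Θ r` cancel, and `x² + y² = 1` turns the determinant into `2 π l² (1 - 2 y r)
∂_s r`, which is `1` by the differentiated root equation. -/
lemma eightMap_area {L : ℝ} (hr : ContMDiff ((𝓡 1).prod 𝓘(ℝ, ℝ)) 𝓘(ℝ, ℝ) ∞ r)
    (heq : ∀ z s, |s| < L + 1 →
      2 * Real.pi * l ^ 2 * (r (z, s) - (z : ℂ).im * r (z, s) ^ 2) = s)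
    (z : Circle) {s : ℝ} (hs : |s| ≤ L) :
    det2 (deriv (fun s => eightMap l r (z, s)) s) (dTheta (fun z => eightMap l r (z, s)) z) = 1 := by
  rw [dTheta, (hasDerivAt_eightMap_left hr z s).deriv, (hasDerivAt_eightMap_right hr z s).deriv,
    det2, ← deriv_root hr heq z hs]
  have h := circle_sq_add_sq z
  simp only
  generalize dTheta (fun z => r (z, s)) z = a
  generalize deriv (fun s => r (z, s)) s = b
  linear_combination (-2 * Real.pi * l ^ 2 * b) * (-1) * h

lemma eightMap_primitive_right (hr : ContMDiff ((𝓡 1).prod 𝓘(ℝ, ℝ)) 𝓘(ℝ, ℝ) ∞ r)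
    (z : Circle) (s : ℝ) :
    (eightMap l r (z, s)).1 * (deriv (fun s => eightMap l r (z, s)) s).2 =
      deriv (fun s => eightPrimitive l r (z, s)) s := by
  rw [(hasDerivAt_eightMap_right hr z s).deriv, (hasDerivAt_eightPrimitive_right hr z s).deriv]
  simp only [eightMap]
  ring

/-- The terms in `∂_Θ r` again agree on both sides; what remains is `2 π l² (r - y r²)`, which is
`s`. -/
lemma eightMap_primitive_left {L : ℝ} (hr : ContMDiff ((𝓡 1).prod 𝓘(ℝ, ℝ)) 𝓘(ℝ, ℝ) ∞ r)
    (heq : ∀ z s, |s| < L + 1 →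
      2 * Real.pi * l ^ 2 * (r (z, s) - (z : ℂ).im * r (z, s) ^ 2) = s)
    (z : Circle) {s : ℝ} (hs : |s| ≤ L) :
    (eightMap l r (z, s)).1 * (dTheta (fun z => eightMap l r (z, s)) z).2 =
      dTheta (fun z => eightPrimitive l r (z, s)) z + s := by
  have e1 := (hasDerivAt_eightMap_left (l := l) hr z s).deriv
  have e2 := (hasDerivAt_eightPrimitive_left (l := l) hr z s).deriv
  change dTheta (fun z => eightMap l r (z, s)) z = _ at e1
  change dTheta (fun z => eightPrimitive l r (z, s)) z = _ at e2
  rw [e1, e2]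
  have h1 := heq z s (by linarith)
  have h2 := circle_sq_add_sq z
  simp only [eightMap]
  generalize dTheta (fun z => r (z, s)) z = a
  generalize r (z, s) = b at *
  have hx : (z : ℂ).re ^ 2 = 1 - (z : ℂ).im ^ 2 := by linarith
  linear_combination h1 + (2 * Real.pi * l ^ 2) * (b - (z : ℂ).im) * h2

end TheMap

end FigureEight

namespace FigureEight

/-! ### Existence of the figure eight map -/

section ExistenceOfMap

lemma eq_pt_of_im_eq_zero {z : Circle} (hz : (z : ℂ).im = 0) : z = pt 0 ∨ z = pt 1 := by
  have h := circle_sq_add_sq z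
  rw [hz] at h
  have h1 : ((z : ℂ).re - 1) * ((z : ℂ).re + 1) = 0 := by linarith
  rcases mul_eq_zero.1 h1 with h2 | h2
  · refine Or.inl (circle_ext ?_ ?_)
    · rw [pt_re, mul_zero, Real.cos_zero]; linarith
    · rw [pt_im, mul_zero, Real.sin_zero, hz]
  · refine Or.inr (circle_ext ?_ ?_)
    · rw [pt_re, mul_one, Real.cos_pi]; linarith
    · rw [pt_im, mul_one, Real.sin_pi, hz]

/-- The figure eight map on an annulus of arbitrary width, together with a primitive of
`a^* (x dy) - s dΘ`. -/
lemma exists_figureEight {δ L : ℝ} (h₀ : 0 < δ) (h₁ : δ < 1 / 2) (hL : 0 ≤ L) :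
    ∃ (a : Circle × ℝ → ℝ × ℝ) (b : Circle × ℝ → ℝ),
      (∀ m M, -L ≤ m → M ≤ L → IsFigureEightMap δ m M a) ∧
      ContMDiff ((𝓡 1).prod 𝓘(ℝ, ℝ)) 𝓘(ℝ, ℝ) ∞ b ∧
      (∀ z s, (a (z, s)).1 * (deriv (fun s => a (z, s)) s).2 = deriv (fun s => b (z, s)) s) ∧
      (∀ z s, |s| ≤ L → (a (z, s)).1 * (dTheta (fun z => a (z, s)) z).2 =
        dTheta (fun z => b (z, s)) z + s) ∧
      (∀ z s z' s', |s| ≤ L → |s'| ≤ L → (s = 0 ∨ z ∉ arc 0 δ ∪ arc 1 δ) →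
        (s' = 0 ∨ z' ∉ arc 0 δ ∪ arc 1 δ) → a (z, s) = a (z', s') →
        (z = z' ∧ s = s') ∨ (z = pt 0 ∧ z' = pt 1) ∨ (z = pt 1 ∧ z' = pt 0)) := by
  have hpi := Real.pi_pos
  set η := Real.sin (Real.pi * δ) with hη
  have hη0 : 0 < η := Real.sin_pos_of_pos_of_lt_pi (by positivity) (by nlinarith)
  obtain ⟨l, r, hl, hr, hr0, hrb, heq⟩ := exists_root_map η L hη0 (Real.sin_le_one _) hL
  -- One statement covers injectivity away from the arcs, the double point of the curve `s = 0`, and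
  -- the mixed case of a point of each kind that the embedding needs.
  have hinj : ∀ (z : Circle) (s : ℝ) (z' : Circle) (s' : ℝ), |s| ≤ L → |s'| ≤ L → (s = 0 ∨ η ≤ |(z : ℂ).im|) →
      (s' = 0 ∨ η ≤ |(z' : ℂ).im|) → eightMap l r (z, s) = eightMap l r (z', s') →
      (z = z' ∧ s = s') ∨
        ((z : ℂ).im = 0 ∧ (z' : ℂ).im = 0 ∧ s = 0 ∧ s' = 0) := by
    intro z s z' s' hs hs' h h' he
    have hsr : ∀ (z : Circle) (s : ℝ), (s = 0 ∨ η ≤ |(z : ℂ).im|) → |s| ≤ L →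
        r (z, s) = 0 ∨ |r (z, s)| < |(z : ℂ).im| / 2 := by
      rintro z s (rfl | h) hs
      · exact Or.inl (hr0 z)
      · exact Or.inr ((hrb z s hs).trans_le (by linarith))
    have h1 := congrArg Prod.fst he
    have h2 := congrArg Prod.snd he
    simp only [eightMap] at h1 h2
    have h3 := mul_left_cancel₀ hl.ne' h1
    have h4 := mul_left_cancel₀ hl.ne' h2
    have e1 := heq z s (by linarith)
    have e2 := heq z' s' (by linarith)
    rcases root_injective (circle_sq_add_sq z) (circle_sq_add_sq z') h3 (by linarith)
      (hsr z s h hs) (hsr z' s' h' hs') with ⟨h5, h6, h7⟩ | ⟨h5, h6, h7, h8⟩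
    · rw [h6, h7, e2] at e1
      exact Or.inl ⟨circle_ext h5 h6, e1.symm⟩
    · rw [h6] at e1
      rw [h8] at e2
      exact Or.inr ⟨h5, h7, by linarith, by linarith⟩
  have hpts : ∀ z z' : Circle, (z : ℂ).im = 0 → (z' : ℂ).im = 0 →
      z = z' ∨ (z = pt 0 ∧ z' = pt 1) ∨ (z = pt 1 ∧ z' = pt 0) := by
    intro z z' h h'
    rcases eq_pt_of_im_eq_zero h with rfl | rfl <;> rcases eq_pt_of_im_eq_zero h' with rfl | rfl <;>
      simp
  have hout : ∀ z : Circle, z ∉ arc 0 δ ∪ arc 1 δ → η ≤ |(z : ℂ).im| := fun z hz =>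
    not_lt.1 fun h => hz (mem_arc_of_im_lt h₀ z h)
  refine ⟨eightMap l r, eightPrimitive l r, fun m M hm hM => ?_, contMDiff_eightPrimitive hr,
    eightMap_primitive_right hr, fun z s => eightMap_primitive_left hr heq z, ?_⟩
  · have habs : ∀ s ∈ Set.Icc m M, |s| ≤ L := fun s hs =>
      abs_le.2 ⟨hm.trans hs.1, hs.2.trans hM⟩
    refine ⟨contMDiff_eightMap hr, fun z s hs => eightMap_area hr heq z (habs s hs),
      ⟨{z | η ≤ |(z : ℂ).im|}, ?_, ?_, ?_⟩, ?_, ?_, ?_, ?_⟩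
    · exact isClosed_le continuous_const contMDiff_circle_im.continuous.abs
    · refine Set.eq_univ_of_forall fun z => ?_
      by_contra hz
      exact hz (Or.inl (Or.inl (hout z fun h => hz (h.elim (fun h => Or.inl (Or.inr h)) Or.inr))))
    · rintro ⟨z, s⟩ ⟨hz, hs⟩ ⟨z', s'⟩ ⟨hz', hs'⟩ he
      rcases hinj z s z' s' (habs s hs) (habs s' hs') (Or.inr hz) (Or.inr hz') he with
        ⟨rfl, rfl⟩ | ⟨h, -⟩
      · rfl
      · have hz1 : η ≤ |(z : ℂ).im| := hz
        rw [h, abs_zero] at hz1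
        exact absurd hz1 hη0.not_ge
    · simp only [eightMap, hr0, pt_re, pt_im]
      simp
    · simp only [eightMap, hr0, pt_re, pt_im]
      simp
    · intro z z' hne he
      rcases hinj z 0 z' 0 (by simpa using hL) (by simpa using hL) (Or.inl rfl) (Or.inl rfl) he with
        h | h
      · exact absurd h.1 hne
      · exact (hpts z z' h.1 h.2.1).resolve_left hne
    -- Both coordinates of the curve are odd in `Θ`, so `x y'` is odd and integrates to zero over
    -- `[-1, 1]`.
    · set g : ℝ → ℝ := fun t => (eightMap l r (pt t, 0)).2 with hg
      have hgodd : (fun t => g (-t)) = fun t => -g t := by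
        funext t
        simp only [hg, eightMap, hr0, pt_re, pt_im, mul_neg, Real.cos_neg, Real.sin_neg]
        ring
      have hderiv : ∀ t, deriv g (-t) = deriv g t := by
        intro t
        have h1 := deriv_comp_neg g t
        rw [hgodd, deriv.fun_neg] at h1
        linarith
      have hfodd : ∀ t, (eightMap l r (pt (-t), 0)).1 * deriv g (-t) =
          -((eightMap l r (pt t, 0)).1 * deriv g t) := by
        intro t
        rw [hderiv]
        simp only [eightMap, hr0, pt_im, mul_neg, Real.sin_neg]
        ring
      have h1 := intervalIntegral.integral_comp_neg (a := (-1 : ℝ)) (b := 1)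
        (fun t => (eightMap l r (pt t, 0)).1 * deriv g t)
      simp only [hfodd, intervalIntegral.integral_neg, neg_neg] at h1
      linarith
  · intro z s z' s' hs hs' h h' he
    rcases hinj z s z' s' hs hs' (h.imp_right (hout z)) (h'.imp_right (hout z')) he with
      h1 | ⟨h1, h2, rfl, rfl⟩
    · exact Or.inl h1
    · rcases hpts z z' h1 h2 with h3 | h3
      · exact Or.inl ⟨h3, rfl⟩
      · exact Or.inr h3

end ExistenceOfMap

/-! ### Derivatives on `W × S¹` in terms of those on the cylinder -/

section Derivatives

lemma mfderiv_smul_tangentUnit {X : Type*} [NormedAddCommGroup X] [NormedSpace ℝ X]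
    {g : Circle → X} {z : Circle} (hg : MDifferentiableAt (𝓡 1) 𝓘(ℝ, X) g z) (c : ℝ) :
    mfderiv (𝓡 1) 𝓘(ℝ, X) g z (c • tangentUnit z) = c • dTheta g z := by
  rw [map_smul, mfderiv_tangentUnit hg]
  rfl

lemma mfderiv_circle_prod_line {X : Type*} [NormedAddCommGroup X] [NormedSpace ℝ X]
    {g : Circle × ℝ → X} (hg : ContMDiff ((𝓡 1).prod 𝓘(ℝ, ℝ)) 𝓘(ℝ, X) ∞ g) (z : Circle) (s c β : ℝ) :
    mfderiv ((𝓡 1).prod 𝓘(ℝ, ℝ)) 𝓘(ℝ, X) g (z, s) (c • tangentUnit z, β) =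
      c • dTheta (fun z => g (z, s)) z + β • deriv (fun s => g (z, s)) s := by
  have h1 : MDifferentiableAt (𝓡 1) 𝓘(ℝ, X) (fun z => g (z, s)) z :=
    (hg.comp (contMDiff_id.prodMk contMDiff_const)).mdifferentiableAt (by simp)
  refine (mfderiv_prod_eq_add_apply (p := (z, s))
    (hg.mdifferentiableAt (by simp))).trans ?_
  refine congrArg₂ (fun x y : X => x + y) (mfderiv_smul_tangentUnit h1 c) ?_
  rw [mfderiv_eq_fderiv]
  exact fderiv_eq_smul_deriv (f := fun s => g (z, s)) β

variable {E' W : Type*} [NormedAddCommGroup E'] [NormedSpace ℝ E']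
  [TopologicalSpace W] [ChartedSpace E' W]

/-- The map `(w, Θ) ↦ (w, ρ Θ)`. -/
def cutoffMap (ρ : Circle → ℝ) (q : W × Circle) : W × ℝ := (q.1, ρ q.2)

lemma contMDiff_cutoffMap {ρ : Circle → ℝ} (hρ : ContMDiff (𝓡 1) 𝓘(ℝ, ℝ) ∞ ρ) :
    ContMDiff (𝓘(ℝ, E').prod (𝓡 1)) (𝓘(ℝ, E').prod 𝓘(ℝ, ℝ)) ∞ (cutoffMap (W := W) ρ) :=
  contMDiff_fst.prodMk (hρ.comp contMDiff_snd)

lemma mfderiv_comp_snd {f : Circle → ℝ} (hf : ContMDiff (𝓡 1) 𝓘(ℝ, ℝ) ∞ f) (q : W × Circle)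
    (u : TangentSpace 𝓘(ℝ, E') q.1) (c : ℝ) :
    mfderiv (𝓘(ℝ, E').prod (𝓡 1)) 𝓘(ℝ, ℝ) (fun q : W × Circle => f q.2) q
      (u, c • tangentUnit q.2) = c * dTheta f q.2 := by
  have h1 : MDifferentiableAt (𝓡 1) 𝓘(ℝ, ℝ) f q.2 := hf.mdifferentiableAt (by simp)
  have h2 := mfderiv_comp q h1 (mdifferentiableAt_snd (I := 𝓘(ℝ, E')) (I' := 𝓡 1))
  rw [mfderiv_snd] at h2
  exact (DFunLike.congr_fun h2 _).trans (mfderiv_smul_tangentUnit h1 c)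

lemma mfderiv_cutoffMap {ρ : Circle → ℝ} (hρ : ContMDiff (𝓡 1) 𝓘(ℝ, ℝ) ∞ ρ) (q : W × Circle)
    (u : TangentSpace 𝓘(ℝ, E') q.1) (c : ℝ) :
    mfderiv (𝓘(ℝ, E').prod (𝓡 1)) (𝓘(ℝ, E').prod 𝓘(ℝ, ℝ)) (cutoffMap ρ) q
      (u, c • tangentUnit q.2) = (u, c * dTheta ρ q.2) := by
  have h1 : MDifferentiableAt (𝓘(ℝ, E').prod (𝓡 1)) 𝓘(ℝ, ℝ) (fun q : W × Circle => ρ q.2) q :=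
    (hρ.comp contMDiff_snd).mdifferentiableAt (by simp)
  have h2 := mfderiv_prodMk (mdifferentiableAt_fst (I := 𝓘(ℝ, E')) (I' := 𝓡 1) (x := q)) h1
  rw [mfderiv_fst] at h2
  refine (DFunLike.congr_fun h2 _).trans ?_
  exact Prod.ext rfl (mfderiv_comp_snd hρ q u c)

variable {E'' H'' N : Type*} [NormedAddCommGroup E''] [NormedSpace ℝ E''] [TopologicalSpace H'']
  [TopologicalSpace N] [ChartedSpace H'' N] {J : ModelWithCorners ℝ E'' H''}

omit [TopologicalSpace W] [ChartedSpace E' W] in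
lemma cutoffMap_mem {δ : ℝ} {ρ : Circle → ℝ} (hρ : IsCutoff δ ρ) (q : W × Circle) :
    cutoffMap ρ q ∈ cylinder W := ⟨Set.mem_univ _, hρ.mem_Icc q.2⟩

lemma contMDiff_comp_cutoffMap {δ : ℝ} {ρ : Circle → ℝ} (hρ : IsCutoff δ ρ) {f : W × ℝ → N}
    (hf : ContMDiffOn (𝓘(ℝ, E').prod 𝓘(ℝ, ℝ)) J ∞ f (cylinder W)) :
    ContMDiff (𝓘(ℝ, E').prod (𝓡 1)) J ∞ (f ∘ cutoffMap ρ) :=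
  hf.comp_contMDiff (contMDiff_cutoffMap hρ.smooth) fun q => cutoffMap_mem hρ q

lemma mfderiv_comp_cutoffMap {δ : ℝ} {ρ : Circle → ℝ} (hρ : IsCutoff δ ρ) {f : W × ℝ → N}
    (hf : ContMDiffOn (𝓘(ℝ, E').prod 𝓘(ℝ, ℝ)) J ∞ f (cylinder W)) (q : W × Circle)
    (u : TangentSpace 𝓘(ℝ, E') q.1) (c : ℝ) :
    mfderiv (𝓘(ℝ, E').prod (𝓡 1)) J (f ∘ cutoffMap ρ) q (u, c • tangentUnit q.2) =
      mfderivWithin (𝓘(ℝ, E').prod 𝓘(ℝ, ℝ)) J f (cylinder W) (cutoffMap ρ q)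
        (u, c * dTheta ρ q.2) := by
  rw [mfderiv_comp_of_mapsTo ((hf _ (cutoffMap_mem hρ q)).mdifferentiableWithinAt (by simp))
    ((contMDiff_cutoffMap hρ.smooth).mdifferentiableAt (by simp)) fun y => cutoffMap_mem hρ y]
  exact congrArg (mfderivWithin (𝓘(ℝ, E').prod 𝓘(ℝ, ℝ)) J f (cylinder W) (cutoffMap ρ q))
    (mfderiv_cutoffMap hρ.smooth q u c)

lemma contMDiff_Phi {δ : ℝ} {ρ : Circle → ℝ} (hρ : IsCutoff δ ρ) {ψ : W × ℝ → ℝ}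
    (hψ : ContMDiffOn (𝓘(ℝ, E').prod 𝓘(ℝ, ℝ)) 𝓘(ℝ, ℝ) ∞ ψ (cylinder W)) :
    ContMDiff (𝓘(ℝ, E').prod (𝓡 1)) 𝓘(ℝ, ℝ) ∞ (Phi ψ ρ) :=
  (contMDiff_comp_cutoffMap hρ hψ).mul ((contMDiff_dTheta hρ.smooth).comp contMDiff_snd)

/-- The derivative of a function on the cylinder in a direction of `E' × ℝ`. -/
noncomputable def cylDeriv (g : W × ℝ → ℝ) (p : W × ℝ) (u : E') (b : ℝ) : ℝ :=
  mfderivWithin (𝓘(ℝ, E').prod 𝓘(ℝ, ℝ)) 𝓘(ℝ, ℝ) g (cylinder W) p (u, b)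

/-- The derivative of a function on `W × S¹` in a direction of `E' × ℝ`, where `ℝ` is identified
with the tangent line of the circle through the parameter. -/
noncomputable def torusDeriv (f : W × Circle → ℝ) (q : W × Circle) (u : E') (c : ℝ) : ℝ :=
  mfderiv (𝓘(ℝ, E').prod (𝓡 1)) 𝓘(ℝ, ℝ) f q (u, c • tangentUnit q.2)

/-- This is `dΦ = ψ ρ'' dΘ + ρ' dψ`; the first term disappears after wedging with `dΘ`. -/
lemma torusDeriv_Phi {δ : ℝ} {ρ : Circle → ℝ} (hρ : IsCutoff δ ρ) {ψ : W × ℝ → ℝ}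
    (hψ : ContMDiffOn (𝓘(ℝ, E').prod 𝓘(ℝ, ℝ)) 𝓘(ℝ, ℝ) ∞ ψ (cylinder W)) (q : W × Circle)
    (u : E') (c : ℝ) :
    torusDeriv (Phi ψ ρ) q u c =
      c * (ψ (cutoffMap ρ q) * dTheta (dTheta ρ) q.2) +
        dTheta ρ q.2 * cylDeriv ψ (cutoffMap ρ q) u (c * dTheta ρ q.2) := by
  have hd := contMDiff_dTheta hρ.smooth
  have h1 : MDifferentiableAt (𝓘(ℝ, E').prod (𝓡 1)) 𝓘(ℝ, ℝ)
      (fun q : W × Circle => dTheta ρ q.2) q :=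
    (hd.comp contMDiff_snd).mdifferentiableAt (by simp)
  have h2 : MDifferentiableAt (𝓘(ℝ, E').prod (𝓡 1)) 𝓘(ℝ, ℝ) (ψ ∘ cutoffMap ρ) q :=
    (contMDiff_comp_cutoffMap hρ hψ).mdifferentiableAt (by simp)
  have h3 := (h2.hasMFDerivAt.mul h1.hasMFDerivAt).mfderiv
  refine (DFunLike.congr_fun h3 (u, c • tangentUnit q.2)).trans ?_
  have h4 : torusDeriv (fun q : W × Circle => dTheta ρ q.2) q u c =
    c * dTheta (dTheta ρ) q.2 := mfderiv_comp_snd hd q u c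
  have h5 : torusDeriv (ψ ∘ cutoffMap ρ) q u c =
    cylDeriv ψ (cutoffMap ρ q) u (c * dTheta ρ q.2) := mfderiv_comp_cutoffMap hρ hψ q u c
  change ψ (cutoffMap ρ q) * torusDeriv (fun q : W × Circle => dTheta ρ q.2) q u c +
    dTheta ρ q.2 * torusDeriv (ψ ∘ cutoffMap ρ) q u c = _
  rw [h4, h5]
  ring

end Derivatives

/-! ### The map into `V × ℝ²`: derivative and injectivity -/

section MainConstruction

variable {E V E' W : Type*} [NormedAddCommGroup E] [NormedSpace ℝ E]
  [TopologicalSpace V] [ChartedSpace E V]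
  [NormedAddCommGroup E'] [NormedSpace ℝ E'] [TopologicalSpace W] [ChartedSpace E' W]

lemma det2_combination (c₁ c₂ β₁ β₂ : ℝ) (x y : ℝ × ℝ) :
    det2 (c₁ • x + β₁ • y) (c₂ • x + β₂ • y) = (β₁ * c₂ - β₂ * c₁) * det2 y x := by
  simp only [det2, Prod.fst_add, Prod.snd_add, Prod.smul_fst, Prod.smul_snd, smul_eq_mul]
  ring

lemma sumOne_apply (θ : OneForm 𝓘(ℝ, E) V) (p : V × (ℝ × ℝ))
    (u : TangentSpace (𝓘(ℝ, E).prod 𝓘(ℝ, ℝ × ℝ)) p) :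
    sumOne θ p u = θ p.1 u.1 + p.2.1 * (u.2 : ℝ × ℝ).2 := by
  simp only [sumOne, Pi.add_apply, OneForm.pullback]
  rw [mfderiv_fst, mfderiv_snd]
  rfl

lemma sumTwo_apply (σ : TwoForm 𝓘(ℝ, E) V) (p : V × (ℝ × ℝ))
    (u v : TangentSpace (𝓘(ℝ, E).prod 𝓘(ℝ, ℝ × ℝ)) p) :
    sumTwo σ p u v = σ p.1 u.1 v.1 + det2 u.2 v.2 := by
  simp only [sumTwo]
  rw [mfderiv_fst, mfderiv_snd]
  rfl

variable {F : W × ℝ → V} {ψ : W × ℝ → ℝ} {δ : ℝ} {ρ : Circle → ℝ} {a : Circle × ℝ → ℝ × ℝ}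

lemma contMDiff_snd_Phi (hρ : IsCutoff δ ρ)
    (hψ : ContMDiffOn (𝓘(ℝ, E').prod 𝓘(ℝ, ℝ)) 𝓘(ℝ, ℝ) ∞ ψ (cylinder W)) :
    ContMDiff (𝓘(ℝ, E').prod (𝓡 1)) ((𝓡 1).prod 𝓘(ℝ, ℝ)) ∞
      (fun q : W × Circle => (q.2, Phi ψ ρ q)) :=
  contMDiff_snd.prodMk (contMDiff_Phi hρ hψ)

lemma contMDiff_figureEight
    (hF : ContMDiffOn (𝓘(ℝ, E').prod 𝓘(ℝ, ℝ)) 𝓘(ℝ, E) ∞ F (cylinder W)) (hρ : IsCutoff δ ρ)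
    (hψ : ContMDiffOn (𝓘(ℝ, E').prod 𝓘(ℝ, ℝ)) 𝓘(ℝ, ℝ) ∞ ψ (cylinder W))
    (ha : ContMDiff ((𝓡 1).prod 𝓘(ℝ, ℝ)) 𝓘(ℝ, ℝ × ℝ) ∞ a) :
    ContMDiff (𝓘(ℝ, E').prod (𝓡 1)) (𝓘(ℝ, E).prod 𝓘(ℝ, ℝ × ℝ)) ∞ (figureEight F ψ ρ a) :=
  (contMDiff_comp_cutoffMap hρ hF).prodMk (ha.comp (contMDiff_snd_Phi hρ hψ))

lemma mfderiv_comp_snd_Phi {X : Type*} [NormedAddCommGroup X] [NormedSpace ℝ X]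
    {g : Circle × ℝ → X} (hg : ContMDiff ((𝓡 1).prod 𝓘(ℝ, ℝ)) 𝓘(ℝ, X) ∞ g) (hρ : IsCutoff δ ρ)
    (hψ : ContMDiffOn (𝓘(ℝ, E').prod 𝓘(ℝ, ℝ)) 𝓘(ℝ, ℝ) ∞ ψ (cylinder W)) (q : W × Circle)
    (u : E') (c : ℝ) :
    mfderiv (𝓘(ℝ, E').prod (𝓡 1)) 𝓘(ℝ, X) (fun q : W × Circle => g (q.2, Phi ψ ρ q)) q
      (u, c • tangentUnit q.2) =
      c • dTheta (fun z => g (z, Phi ψ ρ q)) q.2 +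
        torusDeriv (Phi ψ ρ) q u c •
          deriv (fun s => g (q.2, s)) (Phi ψ ρ q) := by
  have h1 := mfderiv_comp q (hg.mdifferentiableAt (x := (q.2, Phi ψ ρ q)) (by simp))
    ((contMDiff_snd_Phi hρ hψ).mdifferentiableAt (by simp))
  have h2 := mfderiv_prodMk (mdifferentiableAt_snd (I := 𝓘(ℝ, E')) (I' := 𝓡 1) (x := q))
    ((contMDiff_Phi hρ hψ).mdifferentiableAt (x := q) (by simp))
  rw [mfderiv_snd] at h2
  rw [h2] at h1
  exact (DFunLike.congr_fun h1 (u, c • tangentUnit q.2)).trans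
    (mfderiv_circle_prod_line hg q.2 (Phi ψ ρ q) c (torusDeriv (Phi ψ ρ) q u c))

lemma mfderiv_figureEight
    (hF : ContMDiffOn (𝓘(ℝ, E').prod 𝓘(ℝ, ℝ)) 𝓘(ℝ, E) ∞ F (cylinder W)) (hρ : IsCutoff δ ρ)
    (hψ : ContMDiffOn (𝓘(ℝ, E').prod 𝓘(ℝ, ℝ)) 𝓘(ℝ, ℝ) ∞ ψ (cylinder W))
    (ha : ContMDiff ((𝓡 1).prod 𝓘(ℝ, ℝ)) 𝓘(ℝ, ℝ × ℝ) ∞ a) (q : W × Circle)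
    (u : E') (c : ℝ) :
    mfderiv (𝓘(ℝ, E').prod (𝓡 1)) (𝓘(ℝ, E).prod 𝓘(ℝ, ℝ × ℝ)) (figureEight F ψ ρ a) q
      (u, c • tangentUnit q.2) =
      (mfderivWithin (𝓘(ℝ, E').prod 𝓘(ℝ, ℝ)) 𝓘(ℝ, E) F (cylinder W) (cutoffMap ρ q)
        (u, c * dTheta ρ q.2),
      c • dTheta (fun z => a (z, Phi ψ ρ q)) q.2 +
        torusDeriv (Phi ψ ρ) q u c •
          deriv (fun s => a (q.2, s)) (Phi ψ ρ q)) := by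
  have h := mfderiv_prodMk ((contMDiff_comp_cutoffMap hρ hF).mdifferentiableAt (x := q) (by simp))
    ((ha.comp (contMDiff_snd_Phi hρ hψ)).mdifferentiableAt (x := q) (by simp))
  refine (DFunLike.congr_fun h (u, c • tangentUnit q.2)).trans (Prod.ext ?_ ?_)
  · exact mfderiv_comp_cutoffMap hρ hF q u c
  · exact mfderiv_comp_snd_Phi ha hρ hψ q u c

lemma exists_eq_smul_tangentUnit (q : W × Circle)
    (v : TangentSpace (𝓘(ℝ, E').prod (𝓡 1)) q) :
    ∃ (u : E') (c : ℝ),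
      v = ((u, c • tangentUnit q.2) : TangentSpace 𝓘(ℝ, E') q.1 × TangentSpace (𝓡 1) q.2) := by
  obtain ⟨c, hc⟩ := exists_smul_tangentUnit q.2 v.2
  exact ⟨v.1, c, Prod.ext rfl hc⟩

/-- The only coincidences of the plane component with distinct `Θ` pair the parameters `0` and `±1`,
where the `V` components come from the disjoint ends of the isotopy. -/
lemma injective_figureEight {θ : OneForm 𝓘(ℝ, E) V} {L : ℝ}
    (hF : IsExactLagrangianIsotopy (E' := E') θ F)
    (hdisj : ∀ w₀ w₁ : W, F (w₀, 0) ≠ F (w₁, 1)) (hδ : 0 < δ) (hρ : IsCutoff δ ρ)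
    (hL : ∀ q : W × Circle, |Phi ψ ρ q| ≤ L)
    (ha : ∀ z s z' s', |s| ≤ L → |s'| ≤ L → (s = 0 ∨ z ∉ arc 0 δ ∪ arc 1 δ) →
        (s' = 0 ∨ z' ∉ arc 0 δ ∪ arc 1 δ) → a (z, s) = a (z', s') →
        (z = z' ∧ s = s') ∨ (z = pt 0 ∧ z' = pt 1) ∨ (z = pt 1 ∧ z' = pt 0)) :
    Function.Injective (figureEight F ψ ρ a) := by
  have hzero : ∀ q : W × Circle, Phi ψ ρ q = 0 ∨ q.2 ∉ arc 0 δ ∪ arc 1 δ := by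
    intro q
    by_cases hq : q.2 ∈ arc 0 δ ∪ arc 1 δ
    · left
      rw [Phi, hq.elim (dTheta_eq_zero_of_eqOn_arc hρ.eq_zero)
        (dTheta_eq_zero_of_eqOn_arc hρ.eq_one), mul_zero]
    · exact Or.inr hq
  have hρ0 : ρ (pt 0) = 0 := hρ.eq_zero _ ⟨0, by simpa using hδ, rfl⟩
  have hρ1 : ρ (pt 1) = 1 := hρ.eq_one _ ⟨1, by simpa using hδ, rfl⟩
  rintro ⟨w, z⟩ ⟨w', z'⟩ he
  have h1 : F (w, ρ z) = F (w', ρ z') := congrArg Prod.fst he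
  have h2 : a (z, Phi ψ ρ (w, z)) = a (z', Phi ψ ρ (w', z')) := congrArg Prod.snd he
  rcases ha _ _ _ _ (hL _) (hL _) (hzero (w, z)) (hzero (w', z')) h2 with
    ⟨rfl, -⟩ | ⟨rfl, rfl⟩ | ⟨rfl, rfl⟩
  · exact Prod.ext ((hF.lagrangian _ (hρ.mem_Icc z)).isEmbedding.injective h1) rfl
  · rw [hρ0, hρ1] at h1
    exact absurd h1 (hdisj w w')
  · rw [hρ0, hρ1] at h1
    exact absurd h1.symm (hdisj w' w)

end MainConstruction

end FigureEight

open FigureEight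

theorem proposition3p1
    {E V E' W : Type*}
    [NormedAddCommGroup E] [NormedSpace ℝ E] [FiniteDimensional ℝ E]
    [TopologicalSpace V] [ChartedSpace E V] [IsManifold 𝓘(ℝ, E) ∞ V] [T2Space V]
    [NormedAddCommGroup E'] [NormedSpace ℝ E'] [FiniteDimensional ℝ E']
    [TopologicalSpace W] [ChartedSpace E' W] [IsManifold 𝓘(ℝ, E') ∞ W]
    [CompactSpace W] [Nonempty W]
    (θ : FigureEight.OneForm 𝓘(ℝ, E) V) (hθ : FigureEight.IsExactSymplectic θ)
    (F' : W × ℝ → V)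
    (hW : FigureEight.IsExactLagrangianEmbedding 𝓘(ℝ, E') 𝓘(ℝ, E) θ θ.extDeriv
      (fun w => F' (w, 0)))
    (hF' : FigureEight.IsExactLagrangianIsotopy (E' := E') θ F')
    (hdisj : ∀ w₀ w₁ : W, F' (w₀, 0) ≠ F' (w₁, 1))
    (δ : ℝ) (hδ₀ : 0 < δ) (hδ₁ : δ < 1 / 2) :
    (∃ ρ : Circle → ℝ, FigureEight.IsCutoff δ ρ) ∧
    (∃ ψ : W × ℝ → ℝ, FigureEight.IsPotential (E' := E') θ.extDeriv F' ψ) ∧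
    ∀ (ρ : Circle → ℝ) (ψ : W × ℝ → ℝ), FigureEight.IsCutoff δ ρ →
      FigureEight.IsPotential (E' := E') θ.extDeriv F' ψ →
      ∃ Φmin Φmax : ℝ,
        IsLeast (Set.range (FigureEight.Phi ψ ρ)) Φmin ∧
        IsGreatest (Set.range (FigureEight.Phi ψ ρ)) Φmax ∧
        ∃ a : Circle × ℝ → ℝ × ℝ, FigureEight.IsFigureEightMap δ Φmin Φmax a ∧
          FigureEight.IsExactLagrangianEmbedding
            (𝓘(ℝ, E').prod (𝓡 1)) (𝓘(ℝ, E).prod 𝓘(ℝ, ℝ × ℝ))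
            (FigureEight.sumOne θ) (FigureEight.sumTwo θ.extDeriv)
            (FigureEight.figureEight F' ψ ρ a) := by
  refine ⟨exists_isCutoff hδ₁, exists_isPotential hθ.smooth hF', fun ρ ψ hρ hψ => ?_⟩
  have hΦc : Continuous (Phi ψ ρ : W × Circle → ℝ) :=
    (contMDiff_Phi (E' := E') hρ hψ.smooth).continuous
  obtain ⟨m, hm⟩ := (isCompact_range hΦc).exists_isLeast (Set.range_nonempty _)
  obtain ⟨M, hM⟩ := (isCompact_range hΦc).exists_isGreatest (Set.range_nonempty _)
  refine ⟨m, M, hm, hM, ?_⟩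
  -- The annulus map is built on a symmetric range of `s`, so `[m, M]` is enlarged to `[-L, L]`.
  set L := max |m| |M| with hLdef
  have hmem : ∀ q : W × Circle, Phi ψ ρ q ∈ Set.Icc m M := fun q =>
    ⟨hm.2 ⟨q, rfl⟩, hM.2 ⟨q, rfl⟩⟩
  have hmL : -L ≤ m := by linarith [neg_abs_le m, le_max_left |m| |M|]
  have hML : M ≤ L := (le_abs_self M).trans (le_max_right _ _)
  have hL : ∀ q : W × Circle, |Phi ψ ρ q| ≤ L := fun q =>
    abs_le.2 ⟨hmL.trans (hmem q).1, (hmem q).2.trans hML⟩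
  obtain ⟨a, b, ha, hb, hbr, hbl, hinj⟩ := exists_figureEight hδ₀ hδ₁
    ((abs_nonneg m).trans (le_max_left _ _) : 0 ≤ L)
  have haI := ha m M hmL hML
  have hsm := contMDiff_figureEight hF'.smooth hρ hψ.smooth haI.smooth
  have harea := fun q : W × Circle => haI.area q.2 _ (hmem q)
  have hD := mfderiv_figureEight hF'.smooth hρ hψ.smooth haI.smooth
  obtain ⟨G, hG, hdG⟩ := exists_primitive_cylinder hθ.smooth hF'.smooth hW.exact hψ
  refine ⟨a, haI, ⟨hsm, ?_, ?_, ?_, ?_⟩, ?_⟩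
  · intro q
    rw [injective_iff_map_eq_zero]
    intro v hv
    obtain ⟨u, c, rfl⟩ := exists_eq_smul_tangentUnit q v
    have h0 := (hD q u c).symm.trans hv
    have h1 := congrArg Prod.fst h0
    have h2 : c • dTheta (fun z => a (z, Phi ψ ρ q)) q.2 + torusDeriv (Phi ψ ρ) q u c •
      deriv (fun s => a (q.2, s)) (Phi ψ ρ q) = (0 : ℝ × ℝ) := congrArg Prod.snd h0
    -- Pairing the vanishing plane component with `∂_s a` under `dx ∧ dy` gives `-c`, by the area
    -- condition.
    have hc : c = 0 := by
      have h3 := det2_combination c 0 (torusDeriv (Phi ψ ρ) q u c) 1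
        (dTheta (fun z => a (z, Phi ψ ρ q)) q.2) (deriv (fun s => a (q.2, s)) (Phi ψ ρ q))
      rw [h2, harea q] at h3
      simp only [det2, Prod.fst_zero, Prod.snd_zero] at h3
      linarith
    subst hc
    have hFp := (hF'.smooth _ (cutoffMap_mem hρ q)).mdifferentiableWithinAt (by simp)
    have h4 := mfderiv_slice (hρ.mem_Icc q.2) hFp u
    rw [zero_mul] at h1
    have h5 := (hF'.lagrangian _ (hρ.mem_Icc q.2)).immersion q.1
    have h6 : u = 0 := (injective_iff_map_eq_zero _).1 h5 u (h4.trans h1)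
    rw [h6, zero_smul]
    rfl
  -- A continuous injection from a compact space to a Hausdorff space is an embedding.
  · exact (hsm.continuous.isClosedEmbedding
      (injective_figureEight hF' hdisj hδ₀ hρ hL hinj)).isEmbedding
  · intro q v₁ v₂
    obtain ⟨u₁, c₁, rfl⟩ := exists_eq_smul_tangentUnit q v₁
    obtain ⟨u₂, c₂, rfl⟩ := exists_eq_smul_tangentUnit q v₂
    refine (congrArg₂ (sumTwo θ.extDeriv _) (hD q u₁ c₁) (hD q u₂ c₂)).trans ?_
    refine (sumTwo_apply _ _ _ _).trans ?_
    have h1 := hψ.eq _ (cutoffMap_mem hρ q) (u₁, c₁ * dTheta ρ q.2) (u₂, c₂ * dTheta ρ q.2)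
    simp only [mfderiv_snd] at h1
    refine (congrArg₂ (fun x y : ℝ => x + y) h1 (det2_combination c₁ c₂
      (torusDeriv (Phi ψ ρ) q u₁ c₁) (torusDeriv (Phi ψ ρ) q u₂ c₂) _ _)).trans ?_
    rw [harea q, torusDeriv_Phi hρ hψ.smooth, torusDeriv_Phi hρ hψ.smooth]
    change -(cylDeriv ψ (cutoffMap ρ q) u₁ (c₁ * dTheta ρ q.2) * (c₂ * dTheta ρ q.2) -
      cylDeriv ψ (cutoffMap ρ q) u₂ (c₂ * dTheta ρ q.2) * (c₁ * dTheta ρ q.2)) + _ = (0 : ℝ)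
    ring
  · have h := hW.dim
    simp only [Module.finrank_prod, finrank_euclideanSpace_fin, Module.finrank_self]
    omega
  · have hGs := contMDiff_comp_cutoffMap hρ hG
    have hbs := hb.comp (contMDiff_snd_Phi hρ hψ.smooth)
    -- `G` contributes the extra term `ψ ρ' dΘ` and `b` the term `-Φ dΘ`; they cancel by the
    -- definition of `Φ`.
    refine ⟨fun q => G (cutoffMap ρ q) + b (q.2, Phi ψ ρ q), hGs.add hbs, fun q v => ?_⟩
    obtain ⟨u, c, rfl⟩ := exists_eq_smul_tangentUnit q v
    have h1 := mfderiv_add (hGs.mdifferentiableAt (x := q) (by simp))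
      (hbs.mdifferentiableAt (x := q) (by simp))
    have h2 := congrArg₂ (fun x y : ℝ => x + y)
      ((mfderiv_comp_cutoffMap hρ hG q u c).trans
        (hdG _ (cutoffMap_mem hρ q) (u, c * dTheta ρ q.2)))
      (mfderiv_comp_snd_Phi hb hρ hψ.smooth q u c)
    refine Eq.trans ?_ ((DFunLike.congr_fun h1 (u, c • tangentUnit q.2)).trans h2).symm
    refine (congrArg (sumOne θ _) (hD q u c)).trans ((sumOne_apply _ _ _).trans ?_)
    have h3 := hbl q.2 (Phi ψ ρ q) (hL q)
    have h4 := hbr q.2 (Phi ψ ρ q)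
    have h5 : Phi ψ ρ q = ψ (cutoffMap ρ q) * dTheta ρ q.2 := rfl
    refine (add_assoc _ _ _).trans ?_ |>.symm
    refine congrArg₂ (fun x y : ℝ => x + y) rfl ?_
    change ψ (cutoffMap ρ q) * (c * dTheta ρ q.2) +
      (c * dTheta (fun z => b (z, Phi ψ ρ q)) q.2 +
        torusDeriv (Phi ψ ρ) q u c * deriv (fun s => b (q.2, s)) (Phi ψ ρ q)) =
      (a (q.2, Phi ψ ρ q)).1 * (c * (dTheta (fun z => a (z, Phi ψ ρ q)) q.2).2 +
        torusDeriv (Phi ψ ρ) q u c * (deriv (fun s => a (q.2, s)) (Phi ψ ρ q)).2)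
    linear_combination (-c) * h3 - torusDeriv (Phi ψ ρ) q u c * h4 - c * h5
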